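/- Let $\mathcal X,\mathcal Y$ be finite sets, $p_{XY}$ a probability mass function on $\mathcal X\times\mathcal Y$ with support $S_{XY}$, and $f:\mathcal X\times\mathcal Y\to\mathcal Z$ a function; $(X_i,Y_i)$ are i.i.d. copies of $(X,Y)\sim p_{XY}$. Information quantities are in bits. Relay network. A scheme of block length $n$ consists of encoders $\phi_A:\mathcal X^n\to\{0,1\}^*$, $\phi_B:\mathcal Y^n\to\{0,1\}^*$ and $\phi_C:\phi_A(\mathcal X^n)\times\phi_B(\mathcal Y^n)\to\{0,1\}^*$, whose sets of codewords are prefix free, and of decoders $\psi_A,\psi_B$ with values in $\mathcal Z^n$. It is an unrestricted input scheme if for all $x^n\in\mathcal X^n$, $y^n\in\mathcal Y^n$ and all $i$ with $(x_i,y_i)\in S_{XY}$, the $i$-th components of $\psi_A(x^n,m)$ and $\psi_B(y^n,m)$, where $m=\phi_C(\phi_A(x^n),\phi_B(y^n))$, both equal $f(x_i,y_i)$. A triple $(R_A,R_B,R_C)$ is achievable if for every $\epsilon>0$ and all large enough $n$ there is such a scheme with $\frac1nE|\phi_A(X^n)|\le R_A+\epsilon$, $\frac1nE|\phi_B(Y^n)|\le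 R_B+\epsilon$ and $\frac1nE|\phi_C(\phi_A(X^n),\phi_B(Y^n))|\le R_C+\epsilon$. The region $\mathcal R^{(u)}(f,X,Y)$ is the closure of the convex hull of the set of achievable triples. Graphs. For a graph $G$, $\Gamma(G)$ is the set of its independent sets; for a random vertex $V$, the graph entropy is $H_G(V)=\min I(W;V)$ over all conditional distributions $p_{W|V}$ with $V\in W\in\Gamma(G)$. In $G^f_{X|Y}$, with vertex set $\mathcal X$, $x$ and $x'$ are adjacent iff there is $y$ with $(x,y),(x',y)\in S_{XY}$ and $f(x,y)\ne f(x',y)$; $G^f_{Y|X}$ on $\mathcal Y$ is defined in the same way. Given $p(u_1|x),p(u_2|y)$ with $X\in U_1\in\Gamma(G^f_{X|Y})$ and $Y\in U_2\in\Gamma(G^f_{Y|X})$, and $p(x,u_1,y,u_2)=p_{XY}(x,y)p(u_1|x)p(u_2|y)$, distinct pairs $(u_1,u_2)$, $(u_1',u_2')$ are adjacent in $G^f_{U_1U_2}$ iff there are $(x,y),(x',y')$ with $p(x,u_1,y,u_2)>0$, $p(x',u_1',y',u_2')>0$, $f(x,y)\ne f(x',y')$, and either $x=x',u_1=u_1'$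 or $y=y',u_2=u_2'$. Regions. Let $\mathcal R_{I1}$ be the set of all $(R_A,R_B,R_C)$ with $$R_A\ge I(X;U_1|Q),\quad R_B\ge I(Y;U_2|Q),\quad R_C\ge I(W;U_1,U_2|Q)$$ for some $Q$ with a finite alphabet, independent of $(X,Y)$, and some $p(q)\,p(u_1|x,q)\,p(u_2|y,q)\,p(w|u_1,u_2,q)$ such that, for every $q$, $X\in U_1\in\Gamma(G^f_{X|Y})$, $Y\in U_2\in\Gamma(G^f_{Y|X})$ and $(U_1,U_2)\in W\in\Gamma(G^f_{U_1U_2})$, where $G^f_{U_1U_2}$ is formed with $p(u_1|x,q)$ and $p(u_2|y,q)$. Let $$\mathcal R_{I2}=\{(R_A,R_B,R_C): R_A\ge H_{G^f_{X|Y}}(X),\ R_B\ge H_{G^f_{Y|X}}(Y),\ R_C\ge\max\{H_{G^f_{X|Y}}(X),H_{G^f_{Y|X}}(Y)\}\}.$$ Theorem. (a) The convex closure (closure of the convex hull) of $\mathcal R_{I1}\cup\mathcal R_{I2}$ is contained in $\mathcal R^{(u)}(f,X,Y)$. (b) In general neither of $\mathcal R_{I1}$, $\mathcal R_{I2}$ is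 a subset of the other: there are $p_{XY}$ and $f$ on finite alphabets with $\mathcal R_{I1}\not\subseteq\mathcal R_{I2}$, and there are $p_{XY}$ and $f$ on finite alphabets with $\mathcal R_{I2}\not\subseteq\mathcal R_{I1}$. -/

import Mathlib

open Filter

noncomputable section

namespace RelayNet

universe u v w

/-! ### Information measures (in bits) of finite probability mass functions -/

/-- Mutual information `I(A;B)`, in bits, of a pair `(A,B)` with joint probability mass
function `j`. Terms with `j (a, b) = 0` vanish; where `j (a, b) > 0` both marginals are positive. -/
def mutualInfo {α : Type u} {β : Type v} [Fintype α] [Fintype β] (j : α × β → ℝ) : ℝ :=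
  ∑ a, ∑ b, j (a, b) * Real.logb 2 (j (a, b) / ((∑ b', j (a, b')) * (∑ a', j (a', b))))

/-- `κ` is a conditional probability mass function (a channel) from `α` to `β`. -/
def IsChannel {α : Type u} {β : Type v} [Fintype β] (κ : α → β → ℝ) : Prop :=
  ∀ a, κ a ∈ stdSimplex ℝ β

/-- The joint probability mass function `p(a) κ(b|a)`. -/
def jointPmf {α : Type u} {β : Type v} (p : α → ℝ) (κ : α → β → ℝ) : α × β → ℝ :=
  fun ab => p ab.1 * κ ab.1 ab.2

/-- The first marginal `p_X` of `p_{XY}`. -/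
def margX {𝒳 : Type u} {𝒴 : Type v} [Fintype 𝒴] (p : 𝒳 × 𝒴 → ℝ) : 𝒳 → ℝ :=
  fun x => ∑ y, p (x, y)

/-- The second marginal `p_Y` of `p_{XY}`. -/
def margY {𝒳 : Type u} {𝒴 : Type v} [Fintype 𝒳] (p : 𝒳 × 𝒴 → ℝ) : 𝒴 → ℝ :=
  fun y => ∑ x, p (x, y)

/-! ### Graphs -/

/-- The channel `κ(w|v)` satisfies `V ∈ W ∈ Γ(G)`: given `V = v`, the random set `W` is always an
independent set of `G` that contains `v`. -/
def IsIndepChannel {V : Type u} [Fintype V] (G : SimpleGraph V) (κ : V → Finset V → ℝ) : Prop :=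
  IsChannel κ ∧ ∀ v w, 0 < κ v w → v ∈ w ∧ G.IsIndepSet (w : Set V)

/-- Graph entropy `H_G(V) = min I(W;V)` over `V ∈ W ∈ Γ(G)`. -/
def graphEntropy {V : Type u} [Fintype V] (G : SimpleGraph V) (p : V → ℝ) : ℝ :=
  sInf {t | ∃ κ : V → Finset V → ℝ, IsIndepChannel G κ ∧ t = mutualInfo (jointPmf p κ)}

section
variable {𝒳 : Type u} {𝒴 : Type v} {𝒵 : Type w}

/-- The `f`-confusability graph `G_{X|Y}^f` on `𝒳`. -/
def confGraphX (p : 𝒳 × 𝒴 → ℝ) (f : 𝒳 → 𝒴 → 𝒵) : SimpleGraph 𝒳 where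
  Adj x x' := ∃ y, 0 < p (x, y) ∧ 0 < p (x', y) ∧ f x y ≠ f x' y
  symm := ⟨fun _ _ ⟨y, h, h', hf⟩ => ⟨y, h', h, hf.symm⟩⟩
  loopless := ⟨fun _ ⟨_, _, _, hf⟩ => hf rfl⟩

/-- The `f`-confusability graph `G_{Y|X}^f` on `𝒴`. -/
def confGraphY (p : 𝒳 × 𝒴 → ℝ) (f : 𝒳 → 𝒴 → 𝒵) : SimpleGraph 𝒴 where
  Adj y y' := ∃ x, 0 < p (x, y) ∧ 0 < p (x, y') ∧ f x y ≠ f x y'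
  symm := ⟨fun _ _ ⟨x, h, h', hf⟩ => ⟨x, h', h, hf.symm⟩⟩
  loopless := ⟨fun _ ⟨_, _, _, hf⟩ => hf rfl⟩

/-- The joint probability mass function `p(x,y) p(u₁|x) p(u₂|y)` of `(X,U₁,Y,U₂)`. -/
def jointXUYU (p : 𝒳 × 𝒴 → ℝ) (κ₁ : 𝒳 → Finset 𝒳 → ℝ) (κ₂ : 𝒴 → Finset 𝒴 → ℝ)
    (x : 𝒳) (u₁ : Finset 𝒳) (y : 𝒴) (u₂ : Finset 𝒴) : ℝ :=
  p (x, y) * κ₁ x u₁ * κ₂ y u₂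

/-- The joint probability mass function of `(U₁,U₂)`. -/
def pmfUU [Fintype 𝒳] [Fintype 𝒴]
    (p : 𝒳 × 𝒴 → ℝ) (κ₁ : 𝒳 → Finset 𝒳 → ℝ) (κ₂ : 𝒴 → Finset 𝒴 → ℝ) :
    Finset 𝒳 × Finset 𝒴 → ℝ :=
  fun u => ∑ x, ∑ y, jointXUYU p κ₁ κ₂ x u.1 y u.2

/-- The relation between `u = (u₁,u₂)` and `u' = (u₁',u₂')` that defines the edges of
`G_{U₁U₂}^f`. -/
def auxRel (p : 𝒳 × 𝒴 → ℝ) (f : 𝒳 → 𝒴 → 𝒵)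
    (κ₁ : 𝒳 → Finset 𝒳 → ℝ) (κ₂ : 𝒴 → Finset 𝒴 → ℝ) (u u' : Finset 𝒳 × Finset 𝒴) : Prop :=
  ∃ x y x' y', 0 < jointXUYU p κ₁ κ₂ x u.1 y u.2 ∧ 0 < jointXUYU p κ₁ κ₂ x' u'.1 y' u'.2 ∧
    ((x = x' ∧ u.1 = u'.1 ∧ f x y ≠ f x' y') ∨ (y = y' ∧ u.2 = u'.2 ∧ f x y ≠ f x' y'))

/-- The relation is symmetric. -/
theorem auxRel_symm {p : 𝒳 × 𝒴 → ℝ} {f : 𝒳 → 𝒴 → 𝒵}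
    {κ₁ : 𝒳 → Finset 𝒳 → ℝ} {κ₂ : 𝒴 → Finset 𝒴 → ℝ} {u u' : Finset 𝒳 × Finset 𝒴}
    (h : auxRel p f κ₁ κ₂ u u') : auxRel p f κ₁ κ₂ u' u := by
  obtain ⟨x, y, x', y', h1, h2, h3⟩ := h
  refine ⟨x', y', x, y, h2, h1, ?_⟩
  rcases h3 with ⟨a, b, c⟩ | ⟨a, b, c⟩
  · exact Or.inl ⟨a.symm, b.symm, c.symm⟩
  · exact Or.inr ⟨a.symm, b.symm, c.symm⟩

/-- The graph `G_{U₁U₂}^f`. The condition `u ≠ u'` only excludes loops. -/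
def auxGraph (p : 𝒳 × 𝒴 → ℝ) (f : 𝒳 → 𝒴 → 𝒵)
    (κ₁ : 𝒳 → Finset 𝒳 → ℝ) (κ₂ : 𝒴 → Finset 𝒴 → ℝ) : SimpleGraph (Finset 𝒳 × Finset 𝒴) where
  Adj u u' := u ≠ u' ∧ auxRel p f κ₁ κ₂ u u'
  symm := ⟨fun _ _ h => ⟨h.1.symm, auxRel_symm h.2⟩⟩
  loopless := ⟨fun _ h => h.1 rfl⟩

/-! ### The two single-letter regions -/

/-- The region `R_{I1}` of triples `(R_A, R_B, R_C)`. The time-sharing variable `Q` ranges over a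
finite alphabet and is independent of `(X,Y)`; a conditional mutual information given `Q` is the
`p(q)`-average of the mutual informations given `Q = q`. -/
def regionI1 [Fintype 𝒳] [Fintype 𝒴] (p : 𝒳 × 𝒴 → ℝ) (f : 𝒳 → 𝒴 → 𝒵) : Set (ℝ × ℝ × ℝ) :=
  {R | ∃ (k : ℕ) (pQ : Fin k → ℝ)
      (κ₁ : Fin k → 𝒳 → Finset 𝒳 → ℝ) (κ₂ : Fin k → 𝒴 → Finset 𝒴 → ℝ)
      (κW : Fin k → Finset 𝒳 × Finset 𝒴 → Finset (Finset 𝒳 × Finset 𝒴) → ℝ),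
      pQ ∈ stdSimplex ℝ (Fin k) ∧
      (∀ q, IsIndepChannel (confGraphX p f) (κ₁ q)) ∧
      (∀ q, IsIndepChannel (confGraphY p f) (κ₂ q)) ∧
      (∀ q, IsIndepChannel (auxGraph p f (κ₁ q) (κ₂ q)) (κW q)) ∧
      ∑ q, pQ q * mutualInfo (jointPmf (margX p) (κ₁ q)) ≤ R.1 ∧
      ∑ q, pQ q * mutualInfo (jointPmf (margY p) (κ₂ q)) ≤ R.2.1 ∧
      ∑ q, pQ q * mutualInfo (jointPmf (pmfUU p (κ₁ q) (κ₂ q)) (κW q)) ≤ R.2.2}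

/-- The region `R_{I2}` of triples `(R_A, R_B, R_C)`. -/
def regionI2 [Fintype 𝒳] [Fintype 𝒴] (p : 𝒳 × 𝒴 → ℝ) (f : 𝒳 → 𝒴 → 𝒵) : Set (ℝ × ℝ × ℝ) :=
  {R | graphEntropy (confGraphX p f) (margX p) ≤ R.1 ∧
      graphEntropy (confGraphY p f) (margY p) ≤ R.2.1 ∧
      max (graphEntropy (confGraphX p f) (margX p)) (graphEntropy (confGraphY p f) (margY p))
        ≤ R.2.2}

end

/-! ### Variable-length schemes for the relay network -/

/-- A set of binary words is prefix free: no word is a proper prefix of another. -/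
def PrefixFree (C : Set (List Bool)) : Prop :=
  ∀ s ∈ C, ∀ t ∈ C, s <+: t → s = t

/-- A variable-length scheme of block length `n`: encoders at A, B and at the relay C, decoders
at A and B. (Only the values of `encC` on pairs of messages sent by A and B, and those of the
decoders on messages sent by C, matter.) -/
structure Scheme (𝒳 : Type u) (𝒴 : Type v) (𝒵 : Type w) (n : ℕ) where
  encA : (Fin n → 𝒳) → List Bool
  encB : (Fin n → 𝒴) → List Bool
  encC : List Bool → List Bool → List Bool
  decA : (Fin n → 𝒳) → List Bool → (Fin n → 𝒵)
  decB : (Fin n → 𝒴) → List Bool → (Fin n → 𝒵)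

namespace Scheme
variable {𝒳 : Type u} {𝒴 : Type v} {𝒵 : Type w} {n : ℕ}

/-- The message broadcast by the relay. -/
def msgC (S : Scheme 𝒳 𝒴 𝒵 n) (x : Fin n → 𝒳) (y : Fin n → 𝒴) : List Bool :=
  S.encC (S.encA x) (S.encB y)

/-- The messages of A, of B and of the relay form prefix-free codes. -/
def IsPrefixFree (S : Scheme 𝒳 𝒴 𝒵 n) : Prop :=
  PrefixFree (Set.range S.encA) ∧ PrefixFree (Set.range S.encB) ∧
    PrefixFree {m | ∃ x y, m = S.msgC x y}

/-- Correct decoding under unrestricted inputs: on all pairs of input vectors, both decoders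
recover `f(x_i, y_i)` in every position `i` with `(x_i, y_i)` in the support. -/
def IsUnrestricted (S : Scheme 𝒳 𝒴 𝒵 n) (p : 𝒳 × 𝒴 → ℝ) (f : 𝒳 → 𝒴 → 𝒵) : Prop :=
  ∀ (x : Fin n → 𝒳) (y : Fin n → 𝒴) (i : Fin n), 0 < p (x i, y i) →
    S.decA x (S.msgC x y) i = f (x i) (y i) ∧ S.decB y (S.msgC x y) i = f (x i) (y i)

variable [Fintype 𝒳] [Fintype 𝒴]

/-- `(1/n) E|M_A|`. -/
def rateA (S : Scheme 𝒳 𝒴 𝒵 n) (p : 𝒳 × 𝒴 → ℝ) : ℝ :=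
  (1 / (n : ℝ)) * ∑ x : Fin n → 𝒳, (∏ i, margX p (x i)) * ((S.encA x).length : ℝ)

/-- `(1/n) E|M_B|`. -/
def rateB (S : Scheme 𝒳 𝒴 𝒵 n) (p : 𝒳 × 𝒴 → ℝ) : ℝ :=
  (1 / (n : ℝ)) * ∑ y : Fin n → 𝒴, (∏ i, margY p (y i)) * ((S.encB y).length : ℝ)

/-- `(1/n) E|M_C|`. -/
def rateC (S : Scheme 𝒳 𝒴 𝒵 n) (p : 𝒳 × 𝒴 → ℝ) : ℝ :=
  (1 / (n : ℝ)) * ∑ x : Fin n → 𝒳, ∑ y : Fin n → 𝒴,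
    (∏ i, p (x i, y i)) * ((S.msgC x y).length : ℝ)

end Scheme

section
variable {𝒳 : Type u} {𝒴 : Type v} {𝒵 : Type w} [Fintype 𝒳] [Fintype 𝒴]

/-- A rate triple is achievable with unrestricted inputs: for every `ε > 0` and all large enough
block lengths there is an unrestricted input scheme whose rates exceed it by at most `ε`. -/
def IsAchievable (p : 𝒳 × 𝒴 → ℝ) (f : 𝒳 → 𝒴 → 𝒵) (R : ℝ × ℝ × ℝ) : Prop :=
  ∀ ε : ℝ, 0 < ε → ∀ᶠ n : ℕ in atTop, ∃ S : Scheme 𝒳 𝒴 𝒵 n,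
    S.IsPrefixFree ∧ S.IsUnrestricted p f ∧
      S.rateA p ≤ R.1 + ε ∧ S.rateB p ≤ R.2.1 + ε ∧ S.rateC p ≤ R.2.2 + ε

/-- The rate region `R^{(u)}(f,X,Y)` under unrestricted inputs: the closure of the convex hull of
the achievable triples. -/
def unrestrictedRegion (p : 𝒳 × 𝒴 → ℝ) (f : 𝒳 → 𝒴 → 𝒵) : Set (ℝ × ℝ × ℝ) :=
  closure (convexHull ℝ {R | IsAchievable p f R})

end

end RelayNet

end

open scoped Topology

namespace RelayNet

universe u v w

/-! Part (a) rests on covering. For a test channel with mutual information I, a codebook of about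
2^(nI) output words suffices to assign to almost every input word, in probability, a codeword that
is possible for it in every coordinate. A and B cover x^n and y^n by sequences u and v of
independent sets. For `regionI1` the relay covers the sequence of pairs (u_i, v_i); for `regionI2`
it sends the XOR of the two codeword indices. Each receiver knows its own codeword. In the first
case, two pairs with the same relay word lie coordinatewise in a common independent set of
`auxGraph`; in the second, cancelling the known index reveals the other codeword. Either way, all
inputs consistent with what a receiver sees give the same value of f at supported positions.
Correctness therefore holds for all inputs; probability only affects lengths. When a covering fails,
a flag bit announces an uncompressed message, of length linear in n, and this event has vanishing
probability.

The delicate point is that the relay covers codewords, which are not i.i.d. The probability that all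
three coverings succeed is linear in each of the three kernels separately. `exists_cover` turns one
kernel into a partial function with few values, losing only a factor, for any nonnegative linear
functional; `exists_chain_cover` does this three times. The initial value is computed with the
product channels restricted to typical pairs, where all laws are i.i.d.; it tends to 1 by
`one_sub_le_chain` and `tendsto_atypMass`. Time sharing is absorbed by the convex hull.

For part (b), f is the OR of two bits with (1,1) of probability zero. Both confusability graphs are
complete, so A and B must reveal their bits, while for `regionI1` the relay need only tell whether
(X,Y) = (0,0). Hence `regionI1` needs R_C ≥ h(P(0,0)), with h the binary entropy, and `regionI2`
needs R_C ≥ max(H(X), H(Y)). Either bound can be made 1 with the other equal to, or below, h(1/4) <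
1. -/

/-! ### One-shot covering -/

/-- The deterministic kernel of a partial function. -/
noncomputable def partialKernel {V W : Type*} (g : V → Option W) (v : V) (w : W) : ℝ :=
  open Classical in if g v = some w then 1 else 0

theorem partialKernel_nonneg {V W : Type*} (g : V → Option W) (v : V) (w : W) :
    0 ≤ partialKernel g v w := by
  unfold partialKernel; split_ifs <;> norm_num

/-- One-shot covering: in a nonnegative linear functional, a kernel `r` dominated by `T • q` can be
replaced by a partial function with at most `M` values, at the cost of a factor. -/
theorem exists_cover {V W : Type*} [Fintype V] [Fintype W] (q : W → ℝ) (hq0 : ∀ w, 0 ≤ q w)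
    (hq1 : ∑ w, q w = 1) (T : ℝ) (hT : 1 ≤ T) (r : V → W → ℝ) (r0 : ∀ v w, 0 ≤ r v w)
    (r1 : ∀ v, ∑ w, r v w ≤ 1) (rT : ∀ v w, r v w ≤ T * q w) (M : ℕ) :
    ∀ (d : V → W → ℝ), (∀ v w, 0 ≤ d v w) →
    ∃ (g : V → Option W) (C : Finset W), C.card ≤ M ∧
      (∀ v w, g v = some w → w ∈ C ∧ 0 < r v w) ∧
      (1 - (1 - 1 / T) ^ M) * ∑ v, ∑ w, d v w * r v w ≤ ∑ v, ∑ w, d v w * partialKernel g v w := by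
  classical
  have hT0 : 0 < T := by linarith
  have hTi : 1 / T ≤ 1 := by rw [div_le_one hT0]; exact hT
  have hTi0 : 0 < 1 / T := by positivity
  induction M with
  | zero =>
    intro d _
    exact ⟨fun _ => none, ∅, by simp, by simp, by simp [partialKernel]⟩
  | succ M ih =>
    intro d hd
    set c : ℝ := 1 - (1 - 1 / T) ^ M with hc
    have hc0 : 0 ≤ c := by
      have : (1 - 1 / T) ^ M ≤ 1 := pow_le_one₀ (by linarith) (by linarith)
      linarith
    -- One more codeword must gain a fraction 1/T of what the factor `c` still misses.
    have hcs : 1 - (1 - 1 / T) ^ (M + 1) = c + 1 / T * (1 - c) := by rw [hc, pow_succ]; ring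
    set D : V → ℝ := fun v => ∑ w, d v w * r v w with hD
    have hD0 : ∀ v, 0 ≤ D v := fun v =>
      Finset.sum_nonneg fun w _ => mul_nonneg (hd v w) (r0 v w)
    -- the gain from letting `w` cover the vertices for which this is profitable
    set S : W → Finset V := fun w => Finset.univ.filter fun v => 0 < r v w ∧ c * D v ≤ d v w with hS
    have gain : ∀ w, ∑ v, r v w / T * (d v w - c * D v) ≤
        q w * ∑ v ∈ S w, (d v w - c * D v) := by
      intro w
      rw [Finset.mul_sum, hS, Finset.sum_filter]
      refine Finset.sum_le_sum fun v _ => ?_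
      have hr : r v w / T ≤ q w := by rw [div_le_iff₀ hT0, mul_comm]; exact rT v w
      have hr' : 0 ≤ r v w / T := div_nonneg (r0 v w) hT0.le
      split_ifs with h
      · exact mul_le_mul_of_nonneg_right hr (by linarith [h.2])
      · rcases (r0 v w).lt_or_eq with h1 | h1
        · have : d v w < c * D v := by
            by_contra h2
            exact h ⟨h1, not_lt.mp h2⟩
          exact mul_nonpos_of_nonneg_of_nonpos hr' (by linarith)
        · simp [← h1]
    -- Averaging argument: for w drawn from `q` the expected gain is at least the left side, because
    -- r/T ≤ q on the profitable pairs and the others contribute at most zero to the sum weighted by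
    -- r/T.
    obtain ⟨w, hw⟩ : ∃ w, 1 / T * (1 - c) * ∑ v, D v ≤ ∑ v ∈ S w, (d v w - c * D v) := by
      by_contra hcon
      push Not at hcon
      have h1 : ∑ w, q w * ∑ v ∈ S w, (d v w - c * D v) < 1 / T * (1 - c) * ∑ v, D v := by
        have : ∑ w, q w * (1 / T * (1 - c) * ∑ v, D v) = 1 / T * (1 - c) * ∑ v, D v := by
          rw [← Finset.sum_mul, hq1, one_mul]
        rw [← this]
        refine Finset.sum_lt_sum (fun w _ => mul_le_mul_of_nonneg_left (hcon w).le (hq0 w)) ?_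
        obtain ⟨w, hw⟩ : ∃ w, 0 < q w := by
          by_contra h
          push Not at h
          have := Finset.sum_nonpos (s := Finset.univ) fun w _ => h w
          linarith
        exact ⟨w, Finset.mem_univ _, mul_lt_mul_of_pos_left (hcon w) hw⟩
      have h2 : ∑ w, ∑ v, r v w / T * (d v w - c * D v) ≤
          ∑ w, q w * ∑ v ∈ S w, (d v w - c * D v) := Finset.sum_le_sum fun w _ => gain w
      have h3 : ∑ w, ∑ v, r v w / T * (d v w - c * D v)
          = ∑ v, (1 / T * D v - 1 / T * c * D v * ∑ w, r v w) := by
        rw [Finset.sum_comm]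
        refine Finset.sum_congr rfl fun v _ => ?_
        have key : ∀ a : ℝ, ∑ w, r v w / T * (d v w - a)
            = 1 / T * ∑ w, d v w * r v w - 1 / T * a * ∑ w, r v w := by
          intro a
          rw [Finset.mul_sum, Finset.mul_sum, ← Finset.sum_sub_distrib]
          exact Finset.sum_congr rfl fun w _ => by ring
        rw [key]
        ring
      have h4 : 1 / T * (1 - c) * ∑ v, D v ≤ ∑ v, (1 / T * D v - 1 / T * c * D v * ∑ w, r v w) := by
        rw [Finset.mul_sum]
        refine Finset.sum_le_sum fun v _ => ?_
        have : 1 / T * c * D v * ∑ w, r v w ≤ 1 / T * c * D v * 1 :=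
          mul_le_mul_of_nonneg_left (r1 v) (by have := hD0 v; positivity)
        linarith
      linarith
    -- The vertices of `S w` are served by `w`, so the remaining M codewords only have to cover the
    -- rest. This is why the induction is over all weights `d`.
    obtain ⟨g, C, hC, hg, hcov⟩ := ih (fun v w' => if v ∈ S w then 0 else d v w') (fun v w' => by
      split_ifs
      · exact le_rfl
      · exact hd v w')
    refine ⟨fun v => if v ∈ S w then some w else g v, insert w C,
      (Finset.card_insert_le _ _).trans (by omega), ?_, ?_⟩
    · intro v w' h
      dsimp only at h
      split_ifs at h with hv
      · cases h
        exact ⟨Finset.mem_insert_self _ _, (Finset.mem_filter.mp hv).2.1⟩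
      · exact ⟨Finset.mem_insert_of_mem (hg v w' h).1, (hg v w' h).2⟩
    · have e1 : ∑ v, ∑ w', (if v ∈ S w then 0 else d v w') * r v w'
          = ∑ v, (if v ∈ S w then 0 else D v) := by
        refine Finset.sum_congr rfl fun v _ => ?_
        split_ifs <;> simp [hD]
      have e2 : ∀ v, ∑ w', d v w' * partialKernel (fun v => if v ∈ S w then some w else g v) v w'
          = (if v ∈ S w then d v w else 0) +
            ∑ w', (if v ∈ S w then 0 else d v w') * partialKernel g v w' := by
        intro v
        by_cases hv : v ∈ S w
        · simp [partialKernel, hv]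
        · simp [partialKernel, hv]
      have e3 : ∀ v, D v = (if v ∈ S w then D v else 0) + (if v ∈ S w then 0 else D v) := by
        intro v; split_ifs <;> simp
      rw [e1] at hcov
      rw [Finset.sum_congr rfl fun v _ => e2 v, Finset.sum_add_distrib, ← Finset.sum_filter]
      have e4 : ∑ v ∈ S w, (d v w - c * D v) = ∑ v ∈ S w, d v w - c * ∑ v ∈ S w, D v := by
        rw [Finset.sum_sub_distrib, Finset.mul_sum]
      have e5 : ∑ v, D v = ∑ v ∈ S w, D v + ∑ v, (if v ∈ S w then 0 else D v) := by
        rw [Finset.sum_congr rfl fun v _ => e3 v, Finset.sum_add_distrib, ← Finset.sum_filter]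
        simp
      have e6 : (Finset.univ.filter fun v => v ∈ S w) = S w := by ext; simp
      rw [e6, hcs]
      rw [e4] at hw
      change (c + 1 / T * (1 - c)) * ∑ v, D v ≤ _
      have : c * ∑ v, D v = c * ∑ v ∈ S w, D v + c * ∑ v, (if v ∈ S w then 0 else D v) := by
        rw [e5]; ring
      linarith

/-- Three coverings in a row: nodes A and B cover their inputs, the relay covers the pair of their
outputs. -/
theorem exists_chain_cover {X Y U₁ U₂ V W : Type*} [Fintype X] [Fintype Y] [Fintype U₁]
    [Fintype U₂] [Fintype V] [Fintype W] (p : X → Y → ℝ) (p0 : ∀ x y, 0 ≤ p x y)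
    (m : U₁ → U₂ → V)
    (q₁ : U₁ → ℝ) (hq₁0 : ∀ w, 0 ≤ q₁ w) (hq₁ : ∑ w, q₁ w = 1) (T₁ : ℝ) (hT₁ : 1 ≤ T₁)
    (r₁ : X → U₁ → ℝ) (r₁0 : ∀ v w, 0 ≤ r₁ v w) (hr₁ : ∀ v, ∑ w, r₁ v w ≤ 1)
    (rT₁ : ∀ v w, r₁ v w ≤ T₁ * q₁ w) (M₁ : ℕ)
    (q₂ : U₂ → ℝ) (hq₂0 : ∀ w, 0 ≤ q₂ w) (hq₂ : ∑ w, q₂ w = 1) (T₂ : ℝ) (hT₂ : 1 ≤ T₂)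
    (r₂ : Y → U₂ → ℝ) (r₂0 : ∀ v w, 0 ≤ r₂ v w) (hr₂ : ∀ v, ∑ w, r₂ v w ≤ 1)
    (rT₂ : ∀ v w, r₂ v w ≤ T₂ * q₂ w) (M₂ : ℕ)
    (q₃ : W → ℝ) (hq₃0 : ∀ w, 0 ≤ q₃ w) (hq₃ : ∑ w, q₃ w = 1) (T₃ : ℝ) (hT₃ : 1 ≤ T₃)
    (r₃ : V → W → ℝ) (r₃0 : ∀ v w, 0 ≤ r₃ v w) (hr₃ : ∀ v, ∑ w, r₃ v w ≤ 1)
    (rT₃ : ∀ v w, r₃ v w ≤ T₃ * q₃ w) (M₃ : ℕ) :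
    ∃ (g₁ : X → Option U₁) (g₂ : Y → Option U₂) (g₃ : V → Option W)
      (C₁ : Finset U₁) (C₂ : Finset U₂) (C₃ : Finset W),
      C₁.card ≤ M₁ ∧ C₂.card ≤ M₂ ∧ C₃.card ≤ M₃ ∧
      (∀ v w, g₁ v = some w → w ∈ C₁ ∧ 0 < r₁ v w) ∧
      (∀ v w, g₂ v = some w → w ∈ C₂ ∧ 0 < r₂ v w) ∧
      (∀ v w, g₃ v = some w → w ∈ C₃ ∧ 0 < r₃ v w) ∧
      (1 - (1 - 1 / T₁) ^ M₁) * (1 - (1 - 1 / T₂) ^ M₂) * (1 - (1 - 1 / T₃) ^ M₃) *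
        ∑ x, ∑ y, p x y * ∑ u₁, ∑ u₂, ∑ w, r₁ x u₁ * r₂ y u₂ * r₃ (m u₁ u₂) w ≤
      ∑ x, ∑ y, p x y * ∑ u₁, ∑ u₂, ∑ w, partialKernel g₁ x u₁ * partialKernel g₂ y u₂ *
        partialKernel g₃ (m u₁ u₂) w := by
  classical
  have hc : ∀ (T : ℝ) (M : ℕ), 1 ≤ T → 0 ≤ 1 - (1 - 1 / T) ^ M := fun T M hT => by
    have hTi : 1 / T ≤ 1 := by rw [div_le_one (by linarith)]; exact hT
    have hTi0 : 0 ≤ 1 / T := by positivity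
    have : (1 - 1 / T) ^ M ≤ 1 := pow_le_one₀ (by linarith) (by linarith)
    linarith
  -- In each of the three applications the weight freezes the other two kernels: those treated
  -- earlier as partial functions, the later ones still as `r`. The last weight is the pushforward
  -- along `m` of the law of the chosen codewords.
  obtain ⟨g₁, C₁, h1, h1', h1''⟩ := exists_cover q₁ hq₁0 hq₁ T₁ hT₁ r₁ r₁0 hr₁ rT₁ M₁
    (fun x u₁ => ∑ y, ∑ u₂, ∑ w, p x y * r₂ y u₂ * r₃ (m u₁ u₂) w) (fun x u₁ =>
      Finset.sum_nonneg fun y _ => Finset.sum_nonneg fun u₂ _ => Finset.sum_nonneg fun w _ =>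
        mul_nonneg (mul_nonneg (p0 _ _) (r₂0 _ _)) (r₃0 _ _))
  obtain ⟨g₂, C₂, h2, h2', h2''⟩ := exists_cover q₂ hq₂0 hq₂ T₂ hT₂ r₂ r₂0 hr₂ rT₂ M₂
    (fun y u₂ => ∑ x, ∑ u₁, ∑ w, p x y * partialKernel g₁ x u₁ * r₃ (m u₁ u₂) w) (fun y u₂ =>
      Finset.sum_nonneg fun x _ => Finset.sum_nonneg fun u₁ _ => Finset.sum_nonneg fun w _ =>
        mul_nonneg (mul_nonneg (p0 _ _) (partialKernel_nonneg _ _ _)) (r₃0 _ _))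
  obtain ⟨g₃, C₃, h3, h3', h3''⟩ := exists_cover q₃ hq₃0 hq₃ T₃ hT₃ r₃ r₃0 hr₃ rT₃ M₃
    (fun v w => ∑ u₁, ∑ u₂, if m u₁ u₂ = v then
      ∑ x, ∑ y, p x y * partialKernel g₁ x u₁ * partialKernel g₂ y u₂ else 0) (fun v w =>
      Finset.sum_nonneg fun u₁ _ => Finset.sum_nonneg fun u₂ _ => by
        split_ifs
        · exact Finset.sum_nonneg fun x _ => Finset.sum_nonneg fun y _ =>
            mul_nonneg (mul_nonneg (p0 _ _) (partialKernel_nonneg _ _ _))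
              (partialKernel_nonneg _ _ _)
        · exact le_rfl)
  refine ⟨g₁, g₂, g₃, C₁, C₂, C₃, h1, h2, h3, h1', h2', h3', ?_⟩
  have A1 : ∀ s : X → U₁ → ℝ,
      ∑ x, ∑ u₁, (∑ y, ∑ u₂, ∑ w, p x y * r₂ y u₂ * r₃ (m u₁ u₂) w) * s x u₁
      = ∑ x, ∑ y, p x y * ∑ u₁, ∑ u₂, ∑ w, s x u₁ * r₂ y u₂ * r₃ (m u₁ u₂) w := by
    intro s
    refine Finset.sum_congr rfl fun x _ => ?_
    simp only [Finset.sum_mul, Finset.mul_sum]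
    rw [Finset.sum_comm]
    refine Finset.sum_congr rfl fun y _ => Finset.sum_congr rfl fun _ _ =>
      Finset.sum_congr rfl fun _ _ => Finset.sum_congr rfl fun _ _ => by ring
  have A2 : ∀ s : Y → U₂ → ℝ,
      ∑ y, ∑ u₂, (∑ x, ∑ u₁, ∑ w, p x y * partialKernel g₁ x u₁ * r₃ (m u₁ u₂) w) * s y u₂
      = ∑ x, ∑ y, p x y * ∑ u₁, ∑ u₂, ∑ w, partialKernel g₁ x u₁ * s y u₂ * r₃ (m u₁ u₂) w := by
    intro s
    rw [Finset.sum_comm (s := (Finset.univ : Finset X))]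
    refine Finset.sum_congr rfl fun y _ => ?_
    simp only [Finset.sum_mul, Finset.mul_sum]
    rw [Finset.sum_comm]
    refine Finset.sum_congr rfl fun x _ => ?_
    rw [Finset.sum_comm]
    refine Finset.sum_congr rfl fun _ _ =>
      Finset.sum_congr rfl fun _ _ => Finset.sum_congr rfl fun _ _ => by ring
  have A3 : ∀ s : V → W → ℝ,
      ∑ v, ∑ w, (∑ u₁, ∑ u₂, if m u₁ u₂ = v then
        ∑ x, ∑ y, p x y * partialKernel g₁ x u₁ * partialKernel g₂ y u₂ else 0) * s v w
      = ∑ x, ∑ y, p x y * ∑ u₁, ∑ u₂, ∑ w, partialKernel g₁ x u₁ * partialKernel g₂ y u₂ *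
        s (m u₁ u₂) w := by
    intro s
    have : ∀ v w, (∑ u₁, ∑ u₂, if m u₁ u₂ = v then
        ∑ x, ∑ y, p x y * partialKernel g₁ x u₁ * partialKernel g₂ y u₂ else 0) * s v w
        = ∑ x, ∑ y, ∑ u₁, ∑ u₂, if m u₁ u₂ = v then
          p x y * (partialKernel g₁ x u₁ * partialKernel g₂ y u₂ * s (m u₁ u₂) w) else 0 := by
      intro v w
      simp only [Finset.sum_mul]
      have : ∀ u₁ u₂, (if m u₁ u₂ = v then
          ∑ x, ∑ y, p x y * partialKernel g₁ x u₁ * partialKernel g₂ y u₂ else 0) * s v w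
          = ∑ x, ∑ y, if m u₁ u₂ = v then
          p x y * (partialKernel g₁ x u₁ * partialKernel g₂ y u₂ * s (m u₁ u₂) w) else 0 := by
        intro u₁ u₂
        split_ifs with h
        · simp only [Finset.sum_mul, h, mul_assoc]
        · simp
      simp only [this]
      calc _ = ∑ u₁, ∑ x, ∑ u₂, ∑ y, _ :=
            Finset.sum_congr rfl fun _ _ => Finset.sum_comm
        _ = ∑ x, ∑ u₁, ∑ u₂, ∑ y, _ := Finset.sum_comm
        _ = ∑ x, ∑ u₁, ∑ y, ∑ u₂, _ := Finset.sum_congr rfl fun _ _ =>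
            Finset.sum_congr rfl fun _ _ => Finset.sum_comm
        _ = _ := Finset.sum_congr rfl fun _ _ => Finset.sum_comm
    simp only [this]
    have e : ∀ (F : V → W → X → Y → U₁ → U₂ → ℝ),
        ∑ v, ∑ w, ∑ x, ∑ y, ∑ u₁, ∑ u₂, F v w x y u₁ u₂
        = ∑ x, ∑ y, ∑ u₁, ∑ u₂, ∑ w, ∑ v, F v w x y u₁ u₂ := by
      intro F
      rw [Finset.sum_comm]
      simp only [← Finset.sum_product']
      exact Finset.sum_nbij' (fun a => (a.2.2.1, a.2.2.2.1, a.2.2.2.2.1, a.2.2.2.2.2, a.1, a.2.1))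
        (fun a => (a.2.2.2.2.1, a.2.2.2.2.2, a.1, a.2.1, a.2.2.1, a.2.2.2.1))
        (by simp) (by simp) (by simp) (by simp) (by simp)
    rw [e]
    simp [Finset.mul_sum]
  rw [A1, A1] at h1''
  rw [A2, A2] at h2''
  rw [A3, A3] at h3''
  calc _ = (1 - (1 - 1 / T₃) ^ M₃) * ((1 - (1 - 1 / T₂) ^ M₂) * ((1 - (1 - 1 / T₁) ^ M₁) *
        ∑ x, ∑ y, p x y * ∑ u₁, ∑ u₂, ∑ w, r₁ x u₁ * r₂ y u₂ * r₃ (m u₁ u₂) w)) := by ring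
    _ ≤ _ := mul_le_mul_of_nonneg_left (mul_le_mul_of_nonneg_left h1'' (hc _ _ hT₂)) (hc _ _ hT₃)
    _ ≤ _ := mul_le_mul_of_nonneg_left h2'' (hc _ _ hT₃)
    _ ≤ _ := h3''

/-! ### Product channels, mutual information bounds and typicality -/

/-- The output distribution of a channel. -/
def outPmf {V W : Type*} [Fintype V] (P : V → ℝ) (κ : V → W → ℝ) (w : W) : ℝ :=
  ∑ v, P v * κ v w

/-- The product channel. -/
def prodKernel {V W : Type*} (κ : V → W → ℝ) (n : ℕ) (v : Fin n → V) (w : Fin n → W) : ℝ :=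
  ∏ i, κ (v i) (w i)

theorem prodKernel_nonneg {V W : Type*} [Fintype W] {κ : V → W → ℝ} (hκ : IsChannel κ) (n : ℕ) (v : Fin n → V)
    (w : Fin n → W) : 0 ≤ prodKernel κ n v w :=
  Finset.prod_nonneg fun i _ => (hκ (v i)).1 (w i)

theorem sum_prodKernel {V W : Type*} [Fintype W] {κ : V → W → ℝ} (hκ : IsChannel κ) (n : ℕ) (v : Fin n → V) :
    ∑ w, prodKernel κ n v w = 1 := by
  classical
  have := Finset.prod_univ_sum (fun _ : Fin n => (Finset.univ : Finset W)) fun i w => κ (v i) w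
  rw [Fintype.piFinset_univ] at this
  unfold prodKernel
  rw [← this]
  simp [(hκ _).2]

section
variable {V W : Type*} [Fintype V] [Fintype W]

theorem outPmf_nonneg {P : V → ℝ} {κ : V → W → ℝ} (hP : P ∈ stdSimplex ℝ V) (hκ : IsChannel κ)
    (w : W) : 0 ≤ outPmf P κ w :=
  Finset.sum_nonneg fun v _ => mul_nonneg (hP.1 v) ((hκ v).1 w)

theorem sum_outPmf {P : V → ℝ} {κ : V → W → ℝ} (hP : P ∈ stdSimplex ℝ V) (hκ : IsChannel κ) :
    ∑ w, outPmf P κ w = 1 := by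
  unfold outPmf
  rw [Finset.sum_comm]
  simp only [← Finset.mul_sum, (hκ _).2, mul_one, hP.2]

theorem outPmf_mem {P : V → ℝ} {κ : V → W → ℝ} (hP : P ∈ stdSimplex ℝ V) (hκ : IsChannel κ) :
    outPmf P κ ∈ stdSimplex ℝ W := ⟨outPmf_nonneg hP hκ, sum_outPmf hP hκ⟩

theorem outPmf_pos {P : V → ℝ} {κ : V → W → ℝ} (hP : P ∈ stdSimplex ℝ V) (hκ : IsChannel κ)
    {v : V} {w : W} (h : 0 < P v * κ v w) : 0 < outPmf P κ w :=
  h.trans_le (Finset.single_le_sum (f := fun v => P v * κ v w)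
    (fun v _ => mul_nonneg (hP.1 v) ((hκ v).1 w)) (Finset.mem_univ v))

theorem mutualInfo_jointPmf {P : V → ℝ} {κ : V → W → ℝ} (hκ : IsChannel κ) :
    mutualInfo (jointPmf P κ) =
      ∑ v, ∑ w, P v * κ v w * Real.logb 2 (κ v w / outPmf P κ w) := by
  unfold mutualInfo jointPmf
  refine Finset.sum_congr rfl fun v _ => Finset.sum_congr rfl fun w _ => ?_
  simp only [← Finset.mul_sum, (hκ v).2, mul_one]
  by_cases hv : P v = 0
  · simp [hv]
  · rw [mul_div_mul_left _ _ hv]; rfl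

/-- A lower bound for mutual information from a nonnegative function of total mass at most one. -/
theorem le_mutualInfo {P : V → ℝ} {κ : V → W → ℝ} (hP : P ∈ stdSimplex ℝ V) (hκ : IsChannel κ)
    (s : V → W → ℝ) (hs : ∀ v w, 0 ≤ s v w)
    (hpos : ∀ v w, 0 < P v * κ v w → 0 < s v w)
    (hs1 : ∑ v, ∑ w, P v * outPmf P κ w * s v w ≤ 1) :
    ∑ v, ∑ w, P v * κ v w * Real.logb 2 (s v w) ≤ mutualInfo (jointPmf P κ) := by
  rw [mutualInfo_jointPmf hκ, ← sub_nonneg, ← Finset.sum_sub_distrib]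
  simp only [← Finset.sum_sub_distrib, ← mul_sub]
  have h2 : 0 < Real.log 2 := Real.log_pos one_lt_two
  have hjoint : ∑ v, ∑ w, P v * κ v w = 1 := by
    simp only [← Finset.mul_sum, (hκ _).2, mul_one, hP.2]
  -- The inequality log t ≥ 1 - 1/t at t = κ/(Q s), with Q the output law. Summed, the left side is
  -- 1 minus the mass of s under P × Q, up to the factor 1/log 2.
  have key : ∀ v w, (P v * κ v w - P v * outPmf P κ w * s v w) / Real.log 2 ≤
      P v * κ v w * (Real.logb 2 (κ v w / outPmf P κ w) - Real.logb 2 (s v w)) := by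
    intro v w
    rcases (mul_nonneg (hP.1 v) ((hκ v).1 w)).lt_or_eq with h | h
    · have hPv : 0 < P v := (pos_iff_pos_of_mul_pos h).2 (pos_of_mul_pos_right h (hP.1 v))
      have hk : 0 < κ v w := pos_of_mul_pos_right h (hP.1 v)
      have hq := outPmf_pos hP hκ h
      have hsp := hpos v w h
      rw [← Real.logb_div (by positivity) (by positivity), Real.logb, ← mul_div_assoc,
        div_le_div_iff_of_pos_right h2]
      have h3 := Real.one_sub_inv_le_log_of_pos (x := κ v w / outPmf P κ w / s v w) (by positivity)
      calc _ = P v * κ v w * (1 - (κ v w / outPmf P κ w / s v w)⁻¹) := by field_simp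
        _ ≤ _ := mul_le_mul_of_nonneg_left h3 h.le
    · rw [← h]
      simp only [zero_mul, zero_sub]
      exact div_nonpos_of_nonpos_of_nonneg (neg_nonpos.mpr (mul_nonneg
        (mul_nonneg (hP.1 v) (outPmf_nonneg hP hκ w)) (hs v w))) h2.le
  refine le_trans ?_ (Finset.sum_le_sum fun v _ => Finset.sum_le_sum fun w _ => key v w)
  simp only [← Finset.sum_div, Finset.sum_sub_distrib, hjoint]
  exact div_nonneg (by linarith) h2.le

theorem mutualInfo_nonneg {P : V → ℝ} {κ : V → W → ℝ} (hP : P ∈ stdSimplex ℝ V)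
    (hκ : IsChannel κ) : 0 ≤ mutualInfo (jointPmf P κ) := by
  have := le_mutualInfo hP hκ (fun _ _ => 1) (fun _ _ => zero_le_one) (fun _ _ _ => one_pos) (by
    simp only [mul_one, ← Finset.mul_sum, sum_outPmf hP hκ, hP.2, le_refl])
  simpa using this

/-- Chernoff exponent: at s = 0 the sum equals 1 and its derivative, the mean of l - m, is negative.
-/
theorem exists_sum_exp_lt_one {P : V → ℝ} (hP : P ∈ stdSimplex ℝ V) (l : V → ℝ) (m : ℝ)
    (hm : ∑ v, P v * l v < m) : ∃ s : ℝ, 0 < s ∧ ∑ v, P v * Real.exp (s * (l v - m)) < 1 := by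
  have hd : HasDerivAt (fun s : ℝ => ∑ v, P v * Real.exp (s * (l v - m)))
      (∑ v, P v * (l v - m)) 0 := by
    refine HasDerivAt.fun_sum fun v _ => ?_
    have := (((hasDerivAt_id (0 : ℝ)).mul_const (l v - m)).exp).const_mul (P v)
    simpa using this
  have hneg : ∑ v, P v * (l v - m) < 0 := by
    simp only [mul_sub, Finset.sum_sub_distrib, ← Finset.sum_mul, hP.2]
    linarith
  have hev := hd.tendsto_slope_zero_right.eventually_lt_const hneg
  obtain ⟨s, hs, hs0⟩ := (hev.and self_mem_nhdsWithin).exists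
  refine ⟨s, hs0, ?_⟩
  have hs0' : (0 : ℝ) < s := hs0
  simp only [zero_add, zero_mul, Real.exp_zero, mul_one, hP.2, smul_eq_mul] at hs
  have := (mul_neg_iff.mp hs).resolve_right (fun h => absurd h.1 (by simp [hs0'.le]))
  linarith [this.2]

theorem sum_sum_prod_eq_pow (F : V → W → ℝ) (n : ℕ) :
    ∑ v : Fin n → V, ∑ w : Fin n → W, ∏ i, F (v i) (w i) = (∑ v, ∑ w, F v w) ^ n := by
  classical
  rw [Fintype.sum_pow]
  refine Finset.sum_congr rfl fun v _ => ?_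
  rw [Finset.prod_univ_sum, Fintype.piFinset_univ]

/-- The product channel, restricted to the pairs for which it is dominated by `T` times the product
output distribution. -/
noncomputable def typKernel (P : V → ℝ) (κ : V → W → ℝ) (T : ℝ) (n : ℕ) (v : Fin n → V)
    (w : Fin n → W) : ℝ :=
  open Classical in
  if prodKernel κ n v w ≤ T * ∏ i, outPmf P κ (w i) then prodKernel κ n v w else 0

theorem sum_prod_pmf {P : V → ℝ} (hP : P ∈ stdSimplex ℝ V) (n : ℕ) :
    ∑ v : Fin n → V, ∏ i, P (v i) = 1 := by
  rw [← Fintype.sum_pow, hP.2, one_pow]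

theorem typKernel_nonneg {P : V → ℝ} {κ : V → W → ℝ} (hκ : IsChannel κ) (T : ℝ) (n : ℕ)
    (v : Fin n → V) (w : Fin n → W) : 0 ≤ typKernel P κ T n v w := by
  unfold typKernel
  split_ifs
  · exact prodKernel_nonneg hκ n v w
  · exact le_rfl

theorem typKernel_le_prodKernel {P : V → ℝ} {κ : V → W → ℝ} (hκ : IsChannel κ) (T : ℝ) (n : ℕ)
    (v : Fin n → V) (w : Fin n → W) : typKernel P κ T n v w ≤ prodKernel κ n v w := by
  unfold typKernel
  split_ifs
  · exact le_rfl
  · exact prodKernel_nonneg hκ n v w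

theorem sum_typKernel_le {P : V → ℝ} {κ : V → W → ℝ} (hκ : IsChannel κ) (T : ℝ) (n : ℕ)
    (v : Fin n → V) : ∑ w, typKernel P κ T n v w ≤ 1 := by
  rw [← sum_prodKernel hκ n v]
  exact Finset.sum_le_sum fun w _ => typKernel_le_prodKernel hκ T n v w

theorem typKernel_le {P : V → ℝ} {κ : V → W → ℝ} (hP : P ∈ stdSimplex ℝ V) (hκ : IsChannel κ)
    {T : ℝ} (hT : 0 ≤ T) (n : ℕ) (v : Fin n → V) (w : Fin n → W) :
    typKernel P κ T n v w ≤ T * ∏ i, outPmf P κ (w i) := by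
  unfold typKernel
  split_ifs with h
  · exact h
  · exact mul_nonneg hT (Finset.prod_nonneg fun i _ => outPmf_nonneg hP hκ _)

theorem pos_of_typKernel_pos {P : V → ℝ} {κ : V → W → ℝ} (hκ : IsChannel κ) {T : ℝ} {n : ℕ}
    {v : Fin n → V} {w : Fin n → W} (h : 0 < typKernel P κ T n v w) (i : Fin n) :
    0 < κ (v i) (w i) := by
  have h1 := h.trans_le (typKernel_le_prodKernel hκ T n v w)
  refine ((hκ (v i)).1 (w i)).lt_of_ne fun h0 => h1.ne' ?_
  exact Finset.prod_eq_zero (Finset.mem_univ i) h0.symm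

/-- The probability of the complement of the typical set. -/
noncomputable def atypMass (P : V → ℝ) (κ : V → W → ℝ) (T : ℝ) (n : ℕ) : ℝ :=
  ∑ v : Fin n → V, ∑ w : Fin n → W,
    (∏ i, P (v i)) * (prodKernel κ n v w - typKernel P κ T n v w)

/-- An atypical pair has information density above n(I + ε), while the mean density per letter is I.
The exponential Markov inequality bounds the probability by the n-th power of a number below 1,
which gives the limit without a law of large numbers. -/
theorem tendsto_atypMass {P : V → ℝ} {κ : V → W → ℝ} (hP : P ∈ stdSimplex ℝ V)
    (hκ : IsChannel κ) {ε : ℝ} (hε : 0 < ε) :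
    Tendsto (fun n : ℕ =>
      atypMass P κ ((2 : ℝ) ^ ((n : ℝ) * (mutualInfo (jointPmf P κ) + ε))) n) atTop (𝓝 0) := by
  classical
  have hlog2 : 0 < Real.log 2 := Real.log_pos one_lt_two
  set m : ℝ := (mutualInfo (jointPmf P κ) + ε) * Real.log 2 with hm
  set l : V → W → ℝ := fun v w => Real.log (κ v w / outPmf P κ w) with hl
  have hmean : ∑ a : V × W, P a.1 * κ a.1 a.2 * l a.1 a.2 < m := by
    have : ∑ a : V × W, P a.1 * κ a.1 a.2 * l a.1 a.2
        = mutualInfo (jointPmf P κ) * Real.log 2 := by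
      rw [mutualInfo_jointPmf hκ, Fintype.sum_prod_type, Finset.sum_mul]
      refine Finset.sum_congr rfl fun v _ => ?_
      rw [Finset.sum_mul]
      refine Finset.sum_congr rfl fun w _ => ?_
      rw [Real.logb, hl]
      field_simp
    rw [this, hm]
    nlinarith
  have hPκ : (fun a : V × W => P a.1 * κ a.1 a.2) ∈ stdSimplex ℝ (V × W) := by
    refine ⟨fun a => mul_nonneg (hP.1 _) ((hκ _).1 _), ?_⟩
    rw [Fintype.sum_prod_type]
    simp only [← Finset.mul_sum, (hκ _).2, mul_one, hP.2]
  obtain ⟨s, hs, hlt⟩ := exists_sum_exp_lt_one hPκ (fun a => l a.1 a.2) m hmean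
  rw [Fintype.sum_prod_type] at hlt
  set F : V → W → ℝ := fun v w => P v * κ v w * Real.exp (s * (l v w - m)) with hF
  have hF0 : ∀ v w, 0 ≤ F v w := fun v w =>
    mul_nonneg (mul_nonneg (hP.1 _) ((hκ _).1 _)) (Real.exp_nonneg _)
  have hlim : Tendsto (fun n : ℕ => (∑ v, ∑ w, F v w) ^ n) atTop (𝓝 0) :=
    tendsto_pow_atTop_nhds_zero_of_lt_one
      (Finset.sum_nonneg fun v _ => Finset.sum_nonneg fun w _ => hF0 v w) hlt
  refine squeeze_zero (fun n => ?_) (fun n => ?_) hlim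
  · exact Finset.sum_nonneg fun v _ => Finset.sum_nonneg fun w _ =>
      mul_nonneg (Finset.prod_nonneg fun i _ => hP.1 _)
        (sub_nonneg.mpr (typKernel_le_prodKernel hκ _ n v w))
  · rw [← sum_sum_prod_eq_pow]
    refine Finset.sum_le_sum fun v _ => Finset.sum_le_sum fun w _ => ?_
    have hprod0 : 0 ≤ ∏ i, F (v i) (w i) := Finset.prod_nonneg fun i _ => hF0 _ _
    unfold typKernel
    split_ifs with h
    · simpa using hprod0
    · rw [sub_zero]
      -- Logarithms split over the coordinates only when every factor is positive; otherwise the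
      -- pair has probability zero.
      by_cases hpos : ∀ i, 0 < P (v i) * κ (v i) (w i)
      · have hq : ∀ i, 0 < outPmf P κ (w i) := fun i => outPmf_pos hP hκ (hpos i)
        have hk : ∀ i, 0 < κ (v i) (w i) := fun i => pos_of_mul_pos_right (hpos i) (hP.1 _)
        have e : ∏ i, F (v i) (w i) = (∏ i, P (v i)) * prodKernel κ n v w *
            Real.exp (s * (∑ i, l (v i) (w i) - n * m)) := by
          simp only [hF, Finset.prod_mul_distrib, ← Real.exp_sum, prodKernel]
          congr 2
          rw [← Finset.mul_sum, Finset.sum_sub_distrib]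
          simp
        rw [e]
        refine le_mul_of_one_le_right (mul_nonneg (Finset.prod_nonneg fun i _ => hP.1 _)
          (prodKernel_nonneg hκ n v w)) (Real.one_le_exp (mul_nonneg hs.le (sub_nonneg.mpr ?_)))
        push Not at h
        have h1 := Real.log_lt_log (by
          have := Finset.prod_pos fun i (_ : i ∈ Finset.univ) => hq i
          positivity) h
        rw [Real.log_mul (by positivity) (Finset.prod_pos fun i _ => hq i).ne',
          Real.log_rpow two_pos, prodKernel, Real.log_prod (fun i _ => (hk i).ne'),
          Real.log_prod (fun i _ => (hq i).ne')] at h1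
        have h2 : ∑ i, l (v i) (w i) =
            ∑ i, Real.log (κ (v i) (w i)) - ∑ i, Real.log (outPmf P κ (w i)) := by
          rw [← Finset.sum_sub_distrib]
          exact Finset.sum_congr rfl fun i _ => Real.log_div (hk i).ne' (hq i).ne'
        rw [h2, hm]
        linarith
      · push Not at hpos
        obtain ⟨i, hi⟩ := hpos
        have : (∏ i, P (v i)) * prodKernel κ n v w = 0 := by
          rw [prodKernel, ← Finset.prod_mul_distrib]
          exact Finset.prod_eq_zero (Finset.mem_univ i)
            (le_antisymm hi (mul_nonneg (hP.1 _) ((hκ _).1 _)))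
        rw [this]
        exact hprod0

/-- With slightly more than `T` trials, each accepted with probability `1 / T`, some trial is
accepted almost surely in the limit. -/
theorem tendsto_coverFactor {I ε : ℝ} (hI : 0 ≤ I) (hε : 0 < ε) :
    Tendsto (fun n : ℕ => 1 - (1 - 1 / (2 : ℝ) ^ ((n : ℝ) * (I + ε / 2))) ^
      ⌊(2 : ℝ) ^ ((n : ℝ) * (I + ε))⌋₊) atTop (𝓝 1) := by
  have hT : ∀ n : ℕ, 1 ≤ (2 : ℝ) ^ ((n : ℝ) * (I + ε / 2)) := fun n =>
    Real.one_le_rpow one_le_two (by positivity)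
  have hlim : Tendsto (fun n : ℕ => Real.exp (-((2 : ℝ) ^ ((n : ℝ) * (ε / 2)) - 1))) atTop (𝓝 0) := by
    refine Real.tendsto_exp_neg_atTop_nhds_zero.comp (tendsto_atTop_add_const_right _ _ ?_)
    refine (tendsto_rpow_atTop_of_base_gt_one 2 one_lt_two).comp ?_
    exact tendsto_natCast_atTop_atTop.atTop_mul_const (by positivity)
  have : Tendsto (fun n : ℕ => (1 - 1 / (2 : ℝ) ^ ((n : ℝ) * (I + ε / 2))) ^
      ⌊(2 : ℝ) ^ ((n : ℝ) * (I + ε))⌋₊) atTop (𝓝 0) := by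
    refine squeeze_zero (fun n => ?_) (fun n => ?_) hlim
    · have := hT n
      exact pow_nonneg (sub_nonneg.mpr ((div_le_one (by linarith)).mpr this)) _
    · have h1 := hT n
      set T := (2 : ℝ) ^ ((n : ℝ) * (I + ε / 2)) with hTdef
      have hT0 : 0 < T := by linarith
      have h2 : 1 - 1 / T ≤ Real.exp (-(1 / T)) := Real.one_sub_le_exp_neg _
      calc _ ≤ Real.exp (-(1 / T)) ^ ⌊(2 : ℝ) ^ ((n : ℝ) * (I + ε))⌋₊ :=
            pow_le_pow_left₀ (sub_nonneg.mpr ((div_le_one hT0).mpr h1)) h2 _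
        _ = Real.exp (-(⌊(2 : ℝ) ^ ((n : ℝ) * (I + ε))⌋₊ / T)) := by
            rw [← Real.exp_nat_mul]; congr 1; ring
        _ ≤ _ := by
            refine Real.exp_le_exp.mpr (neg_le_neg ?_)
            rw [le_div_iff₀ hT0]
            -- The floor loses at most 1, and 1 ≤ T, so M/T ≥ 2^(nε/2) - 1.
            have h3 := Nat.lt_floor_add_one ((2 : ℝ) ^ ((n : ℝ) * (I + ε)))
            have h4 : (2 : ℝ) ^ ((n : ℝ) * (ε / 2)) * T = (2 : ℝ) ^ ((n : ℝ) * (I + ε)) := by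
              rw [hTdef, ← Real.rpow_add two_pos]; congr 1; ring
            rw [sub_mul, h4]
            linarith
  simpa using this.const_sub 1

end

/-! ### Asymptotic covering at the three nodes -/

section
variable {X Y U₁ U₂ V W : Type*} [Fintype X] [Fintype Y] [Fintype U₁] [Fintype U₂] [Fintype W]

/-- Restricting three channels in a chain costs at most the sum of the three masses removed. -/
theorem one_sub_le_chain (p : X → Y → ℝ) (p0 : ∀ x y, 0 ≤ p x y) (hp : ∑ x, ∑ y, p x y = 1)
    (m : U₁ → U₂ → V) {K₁ r₁ : X → U₁ → ℝ} {K₂ r₂ : Y → U₂ → ℝ} {K₃ r₃ : V → W → ℝ}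
    (hK₁ : ∀ x, ∑ u, K₁ x u = 1) (hK₂ : ∀ y, ∑ u, K₂ y u = 1) (hK₃ : ∀ v, ∑ w, K₃ v w = 1)
    (h₁0 : ∀ x u, 0 ≤ r₁ x u) (h₂0 : ∀ y u, 0 ≤ r₂ y u) (h₃0 : ∀ v w, 0 ≤ r₃ v w)
    (h₁ : ∀ x u, r₁ x u ≤ K₁ x u) (h₂ : ∀ y u, r₂ y u ≤ K₂ y u) (h₃ : ∀ v w, r₃ v w ≤ K₃ v w) :
    1 - ∑ x, ∑ u, (∑ y, p x y) * (K₁ x u - r₁ x u) - ∑ y, ∑ u, (∑ x, p x y) * (K₂ y u - r₂ y u)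
      - ∑ u₁, ∑ u₂, ∑ w, (∑ x, ∑ y, p x y * K₁ x u₁ * K₂ y u₂) *
          (K₃ (m u₁ u₂) w - r₃ (m u₁ u₂) w) ≤
    ∑ x, ∑ y, p x y * ∑ u₁, ∑ u₂, ∑ w, r₁ x u₁ * r₂ y u₂ * r₃ (m u₁ u₂) w := by
  have e1 : ∀ x, ∑ u, (∑ y, p x y) * (K₁ x u - r₁ x u)
      = ∑ y, p x y * ∑ u₁, ∑ u₂, ∑ w, (K₁ x u₁ - r₁ x u₁) * K₂ y u₂ * K₃ (m u₁ u₂) w := by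
    intro x
    simp only [← Finset.mul_sum, hK₃, hK₂, mul_one, ← Finset.sum_mul]
  have e2 : ∑ y, ∑ u, (∑ x, p x y) * (K₂ y u - r₂ y u)
      = ∑ x, ∑ y, p x y * ∑ u₁, ∑ u₂, ∑ w, K₁ x u₁ * (K₂ y u₂ - r₂ y u₂) * K₃ (m u₁ u₂) w := by
    simp only [← Finset.mul_sum, hK₃, mul_one, ← Finset.sum_mul, hK₁, one_mul]
    rw [Finset.sum_comm]
    simp only [← Finset.sum_mul]
  -- The third loss is measured with the full kernels `K₁`, `K₂`, not the restricted ones. For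
  -- product channels its input law is then i.i.d.
  have e3 : ∑ u₁, ∑ u₂, ∑ w, (∑ x, ∑ y, p x y * K₁ x u₁ * K₂ y u₂) *
          (K₃ (m u₁ u₂) w - r₃ (m u₁ u₂) w)
      = ∑ x, ∑ y, p x y * ∑ u₁, ∑ u₂, ∑ w, K₁ x u₁ * K₂ y u₂ *
          (K₃ (m u₁ u₂) w - r₃ (m u₁ u₂) w) := by
    simp only [← Finset.mul_sum]
    obtain ⟨G, hG⟩ : ∃ G : U₁ → U₂ → ℝ, ∀ u₁ u₂, ∑ w, (K₃ (m u₁ u₂) w - r₃ (m u₁ u₂) w) = G u₁ u₂ :=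
      ⟨_, fun _ _ => rfl⟩
    simp only [hG, Finset.mul_sum, Finset.sum_mul]
    calc _ = ∑ u₁, ∑ x, ∑ u₂, ∑ y, _ := Finset.sum_congr rfl fun _ _ => Finset.sum_comm
      _ = ∑ x, ∑ u₁, ∑ u₂, ∑ y, _ := Finset.sum_comm
      _ = ∑ x, ∑ u₁, ∑ y, ∑ u₂, _ := Finset.sum_congr rfl fun _ _ =>
          Finset.sum_congr rfl fun _ _ => Finset.sum_comm
      _ = ∑ x, ∑ y, ∑ u₁, ∑ u₂, _ := Finset.sum_congr rfl fun _ _ => Finset.sum_comm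
      _ = _ := by simp only [mul_assoc]
  have e0 : (1 : ℝ) = ∑ x, ∑ y, p x y * ∑ u₁, ∑ u₂, ∑ w, K₁ x u₁ * K₂ y u₂ * K₃ (m u₁ u₂) w := by
    simp only [← Finset.mul_sum, hK₃, mul_one, hK₂, hK₁, hp]
  rw [e2, e3, Finset.sum_congr rfl fun x _ => e1 x]
  nth_rewrite 1 [e0]
  simp only [← Finset.sum_sub_distrib, ← mul_sub]
  refine Finset.sum_le_sum fun x _ => Finset.sum_le_sum fun y _ =>
    mul_le_mul_of_nonneg_left (Finset.sum_le_sum fun u₁ _ => Finset.sum_le_sum fun u₂ _ =>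
      Finset.sum_le_sum fun w _ => ?_) (p0 x y)
  have a1 := h₁0 x u₁
  have a2 := h₂0 y u₂
  have a3 := h₃0 (m u₁ u₂) w
  have b1 := sub_nonneg.mpr (h₁ x u₁)
  have b2 := sub_nonneg.mpr (h₂ y u₂)
  have b3 := sub_nonneg.mpr (h₃ (m u₁ u₂) w)
  generalize r₁ x u₁ = s₁ at *
  generalize r₂ y u₂ = s₂ at *
  generalize r₃ (m u₁ u₂) w = s₃ at *
  obtain ⟨t₁, ht₁⟩ : ∃ t, t = K₁ x u₁ - s₁ := ⟨_, rfl⟩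
  obtain ⟨t₂, ht₂⟩ : ∃ t, t = K₂ y u₂ - s₂ := ⟨_, rfl⟩
  obtain ⟨t₃, ht₃⟩ : ∃ t, t = K₃ (m u₁ u₂) w - s₃ := ⟨_, rfl⟩
  rw [← ht₁] at b1
  rw [← ht₂] at b2
  rw [← ht₃] at b3
  have c1 : K₁ x u₁ = s₁ + t₁ := by rw [ht₁]; ring
  have c2 : K₂ y u₂ = s₂ + t₂ := by rw [ht₂]; ring
  have c3 : K₃ (m u₁ u₂) w = s₃ + t₃ := by rw [ht₃]; ring
  rw [c1, c2, c3, ← sub_nonneg]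
  -- A pointwise union bound: writing K = s + t, the difference is a sum of products with at least
  -- two factors t.
  have : s₁ * s₂ * s₃ - ((s₁ + t₁) * (s₂ + t₂) * (s₃ + t₃) -
      (s₁ + t₁ - s₁) * (s₂ + t₂) * (s₃ + t₃) - (s₁ + t₁) * (s₂ + t₂ - s₂) * (s₃ + t₃) -
      (s₁ + t₁) * (s₂ + t₂) * (s₃ + t₃ - s₃)) =
      s₁ * t₂ * t₃ + t₁ * s₂ * t₃ + t₁ * t₂ * s₃ + 2 * (t₁ * t₂ * t₃) := by ring
  rw [this]
  positivity

end

theorem sum_prod_margX {X Y : Type*} [Fintype Y] (p : X × Y → ℝ) {n : ℕ} (x : Fin n → X) :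
    ∑ y : Fin n → Y, ∏ i, p (x i, y i) = ∏ i, margX p (x i) := by
  classical
  exact (Fintype.prod_sum (fun i y => p (x i, y))).symm

theorem sum_prod_margY {X Y : Type*} [Fintype X] (p : X × Y → ℝ) {n : ℕ} (y : Fin n → Y) :
    ∑ x : Fin n → X, ∏ i, p (x i, y i) = ∏ i, margY p (y i) := by
  classical
  exact (Fintype.prod_sum (fun i x => p (x, y i))).symm

section
variable {X Y : Type*} [Fintype X] [Fintype Y]

theorem margX_mem {p : X × Y → ℝ} (hp : p ∈ stdSimplex ℝ (X × Y)) : margX p ∈ stdSimplex ℝ X := by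
  refine ⟨fun x => Finset.sum_nonneg fun y _ => hp.1 _, ?_⟩
  have := hp.2
  rwa [Fintype.sum_prod_type] at this

theorem margY_mem {p : X × Y → ℝ} (hp : p ∈ stdSimplex ℝ (X × Y)) : margY p ∈ stdSimplex ℝ Y := by
  refine ⟨fun x => Finset.sum_nonneg fun y _ => hp.1 _, ?_⟩
  have := hp.2
  rwa [Fintype.sum_prod_type_right] at this

theorem sum_sum_prod_pmf {p : X × Y → ℝ} (hp : p ∈ stdSimplex ℝ (X × Y)) (n : ℕ) :
    ∑ x : Fin n → X, ∑ y : Fin n → Y, ∏ i, p (x i, y i) = 1 := by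
  simp only [sum_prod_margX, sum_prod_pmf (margX_mem hp)]

variable {U₁ U₂ W : Type*} [Fintype U₁] [Fintype U₂] [Fintype W]

/-- The distribution of the pair of outputs of two channels fed with a correlated pair. -/
def pairPmf (p : X × Y → ℝ) (κ₁ : X → U₁ → ℝ) (κ₂ : Y → U₂ → ℝ) (u : U₁ × U₂) : ℝ :=
  ∑ x, ∑ y, p (x, y) * κ₁ x u.1 * κ₂ y u.2

theorem pairPmf_mem {p : X × Y → ℝ} (hp : p ∈ stdSimplex ℝ (X × Y)) {κ₁ : X → U₁ → ℝ}
    {κ₂ : Y → U₂ → ℝ} (h₁ : IsChannel κ₁) (h₂ : IsChannel κ₂) :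
    pairPmf p κ₁ κ₂ ∈ stdSimplex ℝ (U₁ × U₂) := by
  refine ⟨fun u => Finset.sum_nonneg fun x _ => Finset.sum_nonneg fun y _ =>
    mul_nonneg (mul_nonneg (hp.1 _) ((h₁ _).1 _)) ((h₂ _).1 _), ?_⟩
  -- The two channels used in parallel form a single channel on pairs, whose output law is known to
  -- be a probability.
  have e : outPmf p (fun xy (u : U₁ × U₂) => κ₁ xy.1 u.1 * κ₂ xy.2 u.2) = pairPmf p κ₁ κ₂ := by
    funext u
    simp only [outPmf, pairPmf, Fintype.sum_prod_type, mul_assoc]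
  rw [← e]
  refine sum_outPmf hp fun xy => ⟨fun u => mul_nonneg ((h₁ _).1 _) ((h₂ _).1 _), ?_⟩
  rw [Fintype.sum_prod_type]
  simp only [← Finset.mul_sum, (h₂ _).2, mul_one, (h₁ _).2]

set_option maxHeartbeats 1000000 in
/-- Asymptotic covering at A, at B and at the relay. -/
theorem eventually_exists_covers {p : X × Y → ℝ} (hp : p ∈ stdSimplex ℝ (X × Y))
    {κ₁ : X → U₁ → ℝ} {κ₂ : Y → U₂ → ℝ} {κW : U₁ × U₂ → W → ℝ}
    (h₁ : IsChannel κ₁) (h₂ : IsChannel κ₂) (hW : IsChannel κW) {ε δ : ℝ} (hε : 0 < ε)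
    (hδ : 0 < δ) :
    ∀ᶠ n : ℕ in atTop, ∃ (g₁ : (Fin n → X) → Option (Fin n → U₁))
      (g₂ : (Fin n → Y) → Option (Fin n → U₂)) (g₃ : (Fin n → U₁ × U₂) → Option (Fin n → W))
      (C₁ : Finset (Fin n → U₁)) (C₂ : Finset (Fin n → U₂)) (C₃ : Finset (Fin n → W)),
      (C₁.card : ℝ) ≤ 2 ^ ((n : ℝ) * (mutualInfo (jointPmf (margX p) κ₁) + ε)) ∧
      (C₂.card : ℝ) ≤ 2 ^ ((n : ℝ) * (mutualInfo (jointPmf (margY p) κ₂) + ε)) ∧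
      (C₃.card : ℝ) ≤ 2 ^ ((n : ℝ) * (mutualInfo (jointPmf (pairPmf p κ₁ κ₂) κW) + ε)) ∧
      (∀ x u, g₁ x = some u → u ∈ C₁ ∧ ∀ i, 0 < κ₁ (x i) (u i)) ∧
      (∀ y u, g₂ y = some u → u ∈ C₂ ∧ ∀ i, 0 < κ₂ (y i) (u i)) ∧
      (∀ v w, g₃ v = some w → w ∈ C₃ ∧ ∀ i, 0 < κW (v i) (w i)) ∧
      1 - δ ≤ ∑ x : Fin n → X, ∑ y : Fin n → Y, (∏ i, p (x i, y i)) *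
        ∑ u₁, ∑ u₂, ∑ w, partialKernel g₁ x u₁ * partialKernel g₂ y u₂ *
          partialKernel g₃ (fun i => (u₁ i, u₂ i)) w := by
  classical
  set P₁ := margX p with hP₁def
  set P₂ := margY p with hP₂def
  set P₃ := pairPmf p κ₁ κ₂ with hP₃def
  have hP₁ : P₁ ∈ stdSimplex ℝ X := margX_mem hp
  have hP₂ : P₂ ∈ stdSimplex ℝ Y := margY_mem hp
  have hP₃ : P₃ ∈ stdSimplex ℝ (U₁ × U₂) := pairPmf_mem hp h₁ h₂
  set I₁ := mutualInfo (jointPmf P₁ κ₁) with hI₁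
  set I₂ := mutualInfo (jointPmf P₂ κ₂) with hI₂
  set I₃ := mutualInfo (jointPmf P₃ κW) with hI₃
  have i1 : 0 ≤ I₁ := mutualInfo_nonneg hP₁ h₁
  have i2 : 0 ≤ I₂ := mutualInfo_nonneg hP₂ h₂
  have i3 : 0 ≤ I₃ := mutualInfo_nonneg hP₃ hW
  have hε2 : 0 < ε / 2 := half_pos hε
  have c1 := tendsto_coverFactor i1 hε
  have c2 := tendsto_coverFactor i2 hε
  have c3 := tendsto_coverFactor i3 hε
  have a1 := tendsto_atypMass hP₁ h₁ hε2
  have a2 := tendsto_atypMass hP₂ h₂ hε2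
  have a3 := tendsto_atypMass hP₃ hW hε2
  -- Product of the three covering factors and of the mass kept by the typical kernels. The kernels
  -- use ε/2 and the codebooks ε, which leaves room for the factors to tend to 1.
  have lim := ((c1.mul c2).mul c3).mul (((tendsto_const_nhds (x := (1 : ℝ))).sub a1).sub a2 |>.sub a3)
  have hlt : 1 - δ < 1 * 1 * 1 * (1 - 0 - 0 - 0) := by linarith
  filter_upwards [lim.eventually_const_lt hlt] with n hn
  set T₁ := (2 : ℝ) ^ ((n : ℝ) * (I₁ + ε / 2)) with hT₁
  set T₂ := (2 : ℝ) ^ ((n : ℝ) * (I₂ + ε / 2)) with hT₂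
  set T₃ := (2 : ℝ) ^ ((n : ℝ) * (I₃ + ε / 2)) with hT₃
  have t1 : 1 ≤ T₁ := Real.one_le_rpow one_le_two (by positivity)
  have t2 : 1 ≤ T₂ := Real.one_le_rpow one_le_two (by positivity)
  have t3 : 1 ≤ T₃ := Real.one_le_rpow one_le_two (by positivity)
  set M₁ := ⌊(2 : ℝ) ^ ((n : ℝ) * (I₁ + ε))⌋₊
  set M₂ := ⌊(2 : ℝ) ^ ((n : ℝ) * (I₂ + ε))⌋₊
  set M₃ := ⌊(2 : ℝ) ^ ((n : ℝ) * (I₃ + ε))⌋₊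
  have o1 := outPmf_mem hP₁ h₁
  have o2 := outPmf_mem hP₂ h₂
  have o3 := outPmf_mem hP₃ hW
  obtain ⟨g₁, g₂, g₃, C₁, C₂, C₃, k1, k2, k3, s1, s2, s3, hS⟩ :=
    exists_chain_cover (fun (x : Fin n → X) (y : Fin n → Y) => ∏ i, p (x i, y i))
      (fun x y => Finset.prod_nonneg fun i _ => hp.1 _)
      (fun (u₁ : Fin n → U₁) (u₂ : Fin n → U₂) i => (u₁ i, u₂ i))
      (fun u => ∏ i, outPmf P₁ κ₁ (u i)) (fun u => Finset.prod_nonneg fun i _ => o1.1 _)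
      (sum_prod_pmf o1 n) T₁ t1 (typKernel P₁ κ₁ T₁ n) (typKernel_nonneg h₁ T₁ n)
      (sum_typKernel_le h₁ T₁ n) (typKernel_le hP₁ h₁ (by linarith) n) M₁
      (fun u => ∏ i, outPmf P₂ κ₂ (u i)) (fun u => Finset.prod_nonneg fun i _ => o2.1 _)
      (sum_prod_pmf o2 n) T₂ t2 (typKernel P₂ κ₂ T₂ n) (typKernel_nonneg h₂ T₂ n)
      (sum_typKernel_le h₂ T₂ n) (typKernel_le hP₂ h₂ (by linarith) n) M₂
      (fun u => ∏ i, outPmf P₃ κW (u i)) (fun u => Finset.prod_nonneg fun i _ => o3.1 _)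
      (sum_prod_pmf o3 n) T₃ t3 (typKernel P₃ κW T₃ n) (typKernel_nonneg hW T₃ n)
      (sum_typKernel_le hW T₃ n) (typKernel_le hP₃ hW (by linarith) n) M₃
  refine ⟨g₁, g₂, g₃, C₁, C₂, C₃, ?_, ?_, ?_, fun x u h => ⟨(s1 x u h).1, ?_⟩,
    fun y u h => ⟨(s2 y u h).1, ?_⟩, fun v w h => ⟨(s3 v w h).1, ?_⟩, ?_⟩
  · exact (Nat.cast_le.mpr k1).trans (Nat.floor_le (by positivity))
  · exact (Nat.cast_le.mpr k2).trans (Nat.floor_le (by positivity))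
  · exact (Nat.cast_le.mpr k3).trans (Nat.floor_le (by positivity))
  · exact pos_of_typKernel_pos h₁ (s1 x u h).2
  · exact pos_of_typKernel_pos h₂ (s2 y u h).2
  · exact pos_of_typKernel_pos hW (s3 v w h).2
  · refine hn.le.trans (le_trans (mul_le_mul_of_nonneg_left ?_ ?_) hS)
    · refine le_trans (le_of_eq ?_) (one_sub_le_chain
        (fun (x : Fin n → X) (y : Fin n → Y) => ∏ i, p (x i, y i))
        (fun x y => Finset.prod_nonneg fun i _ => hp.1 _) (sum_sum_prod_pmf hp n)
        (fun (u₁ : Fin n → U₁) (u₂ : Fin n → U₂) i => (u₁ i, u₂ i))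
        (sum_prodKernel h₁ n) (sum_prodKernel h₂ n) (sum_prodKernel hW n)
        (typKernel_nonneg h₁ T₁ n) (typKernel_nonneg h₂ T₂ n) (typKernel_nonneg hW T₃ n)
        (typKernel_le_prodKernel h₁ T₁ n) (typKernel_le_prodKernel h₂ T₂ n)
        (typKernel_le_prodKernel hW T₃ n))
      simp only [sum_prod_margX, sum_prod_margY]
      congr 1
      unfold atypMass
      -- Pairs of n-words are identified with n-words of pairs; the law of the latter is the n-fold
      -- product of `pairPmf`.
      conv_rhs => rw [← Fintype.sum_prod_type']
      refine Fintype.sum_equiv (Equiv.arrowProdEquivProdArrow _ _ _) _ _ fun u => ?_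
      refine Finset.sum_congr rfl fun w _ => ?_
      have : ∏ i, P₃ (u i) = ∑ x : Fin n → X, ∑ y : Fin n → Y,
          (∏ i, p (x i, y i)) * prodKernel κ₁ n x (fun i => (u i).1) *
            prodKernel κ₂ n y (fun i => (u i).2) := by
        simp only [hP₃def, pairPmf, prodKernel, ← Finset.prod_mul_distrib]
        rw [Fintype.prod_sum]
        exact Finset.sum_congr rfl fun x _ =>
          Fintype.prod_sum fun i y => p (x i, y) * κ₁ (x i) (u i).1 * κ₂ y (u i).2
      rw [this]
      rfl
    · have hc : ∀ (T : ℝ) (M : ℕ), 1 ≤ T → 0 ≤ 1 - (1 - 1 / T) ^ M := fun T M hT => by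
        have hTi : 1 / T ≤ 1 := by rw [div_le_one (by linarith)]; exact hT
        have hTi0 : 0 ≤ 1 / T := by positivity
        have : (1 - 1 / T) ^ M ≤ 1 := pow_le_one₀ (by linarith) (by linarith)
        linarith
      exact mul_nonneg (mul_nonneg (hc _ _ t1) (hc _ _ t2)) (hc _ _ t3)

end

/-! ### Prefix-free codes and schemes from coverings -/

theorem PrefixFree.mono {C D : Set (List Bool)} (h : PrefixFree D) (hCD : C ⊆ D) : PrefixFree C :=
  fun s hs t ht hst => h s (hCD hs) t (hCD ht) hst

theorem nonempty_embedding_bits (M : Type*) [Fintype M] :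
    Nonempty (M ↪ (Fin (Nat.clog 2 (Fintype.card M)) → Bool)) := by
  apply Function.Embedding.nonempty_of_card_le
  simpa using Nat.le_pow_clog one_lt_two (Fintype.card M)

theorem sumElim_const_eq_or {α β γ : Type*} (k K : γ) (m : α ⊕ β) :
    Sum.elim (fun _ => k) (fun _ => K) m = k ∨ Sum.elim (fun _ => k) (fun _ => K) m = K := by
  rcases m with _ | _ <;> simp

/-- A two-tier prefix-free code: a flag bit followed by a word of fixed length. -/
theorem exists_prefixCode (M₁ M₂ : Type*) [Fintype M₁] [Fintype M₂] :
    ∃ c : M₁ ⊕ M₂ → List Bool, Function.Injective c ∧ PrefixFree (Set.range c) ∧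
      ∀ m, (c m).length = Sum.elim (fun _ => Nat.clog 2 (Fintype.card M₁) + 1)
        (fun _ => Nat.clog 2 (Fintype.card M₂) + 1) m := by
  obtain ⟨e₁⟩ := nonempty_embedding_bits M₁
  obtain ⟨e₂⟩ := nonempty_embedding_bits M₂
  set c : M₁ ⊕ M₂ → List Bool := Sum.elim (fun m => false :: List.ofFn (e₁ m))
    (fun m => true :: List.ofFn (e₂ m)) with hc
  refine ⟨c, ?_, ?_, ?_⟩
  · rintro (a | a) (b | b) h
    · simpa [hc, List.ofFn_injective.eq_iff] using h
    · simp [hc] at h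
    · simp [hc] at h
    · simpa [hc, List.ofFn_injective.eq_iff] using h
  · rintro _ ⟨a | a, rfl⟩ _ ⟨b | b, rfl⟩ h
    · exact h.eq_of_length (by simp [hc])
    · simp [hc] at h
    · simp [hc] at h
    · exact h.eq_of_length (by simp [hc])
  · rintro (a | a) <;> simp [hc]

section
variable {𝒳 : Type u} {𝒴 : Type v} {𝒵 : Type w}

/-- Abstract messages from which each terminal can recover the function values give a scheme. -/
theorem exists_scheme [Nonempty 𝒵] (p : 𝒳 × 𝒴 → ℝ) (f : 𝒳 → 𝒴 → 𝒵) {n : ℕ}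
    {A₁ A₂ B₁ B₂ C₁ C₂ : Type*} [Fintype A₁] [Fintype A₂] [Fintype B₁] [Fintype B₂]
    [Fintype C₁] [Fintype C₂]
    (a : (Fin n → 𝒳) → A₁ ⊕ A₂) (b : (Fin n → 𝒴) → B₁ ⊕ B₂)
    (c : A₁ ⊕ A₂ → B₁ ⊕ B₂ → C₁ ⊕ C₂)
    (hA : ∀ x y y' i, c (a x) (b y) = c (a x) (b y') → 0 < p (x i, y i) → 0 < p (x i, y' i) →
      f (x i) (y i) = f (x i) (y' i))
    (hB : ∀ x x' y i, c (a x) (b y) = c (a x') (b y) → 0 < p (x i, y i) → 0 < p (x' i, y i) →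
      f (x i) (y i) = f (x' i) (y i)) :
    ∃ S : Scheme 𝒳 𝒴 𝒵 n, S.IsPrefixFree ∧ S.IsUnrestricted p f ∧
      (∀ x, (S.encA x).length = Sum.elim (fun _ => Nat.clog 2 (Fintype.card A₁) + 1)
        (fun _ => Nat.clog 2 (Fintype.card A₂) + 1) (a x)) ∧
      (∀ y, (S.encB y).length = Sum.elim (fun _ => Nat.clog 2 (Fintype.card B₁) + 1)
        (fun _ => Nat.clog 2 (Fintype.card B₂) + 1) (b y)) ∧
      (∀ x y, (S.msgC x y).length = Sum.elim (fun _ => Nat.clog 2 (Fintype.card C₁) + 1)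
        (fun _ => Nat.clog 2 (Fintype.card C₂) + 1) (c (a x) (b y))) := by
  classical
  obtain ⟨cA, iA, pA, lA⟩ := exists_prefixCode A₁ A₂
  obtain ⟨cB, iB, pB, lB⟩ := exists_prefixCode B₁ B₂
  obtain ⟨cC, iC, pC, lC⟩ := exists_prefixCode C₁ C₂
  let msg : (Fin n → 𝒳) → (Fin n → 𝒴) → List Bool := fun x y => cC (c (a x) (b y))
  let S : Scheme 𝒳 𝒴 𝒵 n :=
    { encA := fun x => cA (a x)
      encB := fun y => cB (b y)
      -- The relay decodes the two injective codes; the empty word is a default outside their ranges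
      -- and is never sent.
      encC := Function.extend cA (fun mA => Function.extend cB (fun mB => cC (c mA mB))
        (fun _ => [])) (fun _ _ => [])
      -- Any y consistent with the message and supported at position i will do, since `hA` makes the
      -- value of f independent of the choice. The choice may vary with i.
      decA := fun x m i => if h : ∃ y, m = msg x y ∧ 0 < p (x i, y i) then
        f (x i) (h.choose i) else Classical.arbitrary 𝒵
      decB := fun y m i => if h : ∃ x, m = msg x y ∧ 0 < p (x i, y i) then
        f (h.choose i) (y i) else Classical.arbitrary 𝒵 }
  have hmsg : ∀ x y, S.msgC x y = msg x y := fun x y => by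
    change S.encC (cA (a x)) (cB (b y)) = _
    simp only [S, iA.extend_apply, iB.extend_apply]
    rfl
  refine ⟨S, ⟨pA.mono ?_, pB.mono ?_, pC.mono ?_⟩, fun x y i hp => ⟨?_, ?_⟩, fun x => lA _,
    fun y => lB _, fun x y => ?_⟩
  · rintro _ ⟨x, rfl⟩; exact ⟨_, rfl⟩
  · rintro _ ⟨x, rfl⟩; exact ⟨_, rfl⟩
  · rintro _ ⟨x, y, rfl⟩; exact ⟨_, (hmsg x y).symm⟩
  · rw [hmsg]
    have h : ∃ y', msg x y = msg x y' ∧ 0 < p (x i, y' i) := ⟨y, rfl, hp⟩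
    change (if h : ∃ y', msg x y = msg x y' ∧ 0 < p (x i, y' i) then
      f (x i) (h.choose i) else Classical.arbitrary 𝒵) = _
    rw [dif_pos h]
    exact (hA x y _ i (iC h.choose_spec.1) hp h.choose_spec.2).symm
  · rw [hmsg]
    have h : ∃ x', msg x y = msg x' y ∧ 0 < p (x' i, y i) := ⟨x, rfl, hp⟩
    change (if h : ∃ x', msg x y = msg x' y ∧ 0 < p (x' i, y i) then
      f (h.choose i) (y i) else Classical.arbitrary 𝒵) = _
    rw [dif_pos h]
    exact (hB x _ y i (iC h.choose_spec.1) hp h.choose_spec.2).symm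
  · rw [hmsg]; exact lC _

variable [Fintype 𝒳] [Fintype 𝒴]

/-- Here `s` plays the role of the success indicator: the excess length `K` is charged only to
failure, which has probability at most δ. -/
theorem expect_length_le {p : 𝒳 × 𝒴 → ℝ} (hp : p ∈ stdSimplex ℝ (𝒳 × 𝒴)) {n : ℕ}
    (s : (Fin n → 𝒳) → (Fin n → 𝒴) → ℝ) {δ : ℝ}
    (hs : 1 - δ ≤ ∑ x : Fin n → 𝒳, ∑ y : Fin n → 𝒴, (∏ i, p (x i, y i)) * s x y)
    (L : (Fin n → 𝒳) → (Fin n → 𝒴) → ℝ) (k K : ℝ) (hK : 0 ≤ K)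
    (hL : ∀ x y, L x y ≤ k + (1 - s x y) * K) :
    ∑ x : Fin n → 𝒳, ∑ y : Fin n → 𝒴, (∏ i, p (x i, y i)) * L x y ≤ k + δ * K := by
  have h1 : ∑ x : Fin n → 𝒳, ∑ y : Fin n → 𝒴, (∏ i, p (x i, y i)) * L x y ≤
      ∑ x : Fin n → 𝒳, ∑ y : Fin n → 𝒴,
        ((∏ i, p (x i, y i)) * (k + K) - (∏ i, p (x i, y i)) * s x y * K) :=
    Finset.sum_le_sum fun x _ => Finset.sum_le_sum fun y _ => by
      have h0 : 0 ≤ ∏ i, p (x i, y i) := Finset.prod_nonneg fun i _ => hp.1 (x i, y i)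
      have := mul_le_mul_of_nonneg_left (hL x y) h0
      linarith
  simp only [Finset.sum_sub_distrib, ← Finset.sum_mul, sum_sum_prod_pmf hp n] at h1
  nlinarith [mul_le_mul_of_nonneg_right hs hK]

theorem clog_card_finset_pi (n : ℕ) :
    Nat.clog 2 (Fintype.card (Fin n → Finset 𝒳)) = n * Fintype.card 𝒳 := by
  rw [Fintype.card_fun, Fintype.card_finset, Fintype.card_fin, ← pow_mul, Nat.clog_pow _ _ one_lt_two,
    mul_comm]

/-- Coverings that succeed with high probability give a scheme; whenever one of them fails, the
nodes send sets without compression. -/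
theorem exists_scheme_of_covers [Nonempty 𝒵] {p : 𝒳 × 𝒴 → ℝ} (hp : p ∈ stdSimplex ℝ (𝒳 × 𝒴))
    (f : 𝒳 → 𝒴 → 𝒵) {n : ℕ} {D : Type*} [Fintype D]
    (g₁ : (Fin n → 𝒳) → Option (Fin n → Finset 𝒳)) (C₁ : Finset (Fin n → Finset 𝒳))
    (g₂ : (Fin n → 𝒴) → Option (Fin n → Finset 𝒴)) (C₂ : Finset (Fin n → Finset 𝒴))
    (gC : (Fin n → Finset 𝒳) → (Fin n → Finset 𝒴) → Option D)
    (h₁ : ∀ x u, g₁ x = some u →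
      u ∈ C₁ ∧ ∀ i, x i ∈ u i ∧ (confGraphX p f).IsIndepSet (u i : Set 𝒳))
    (h₂ : ∀ y u, g₂ y = some u →
      u ∈ C₂ ∧ ∀ i, y i ∈ u i ∧ (confGraphY p f).IsIndepSet (u i : Set 𝒴))
    (hA : ∀ x y y' u v v' d i, g₁ x = some u → g₂ y = some v → g₂ y' = some v' →
      gC u v = some d → gC u v' = some d → 0 < p (x i, y i) → 0 < p (x i, y' i) →
      f (x i) (y i) = f (x i) (y' i))
    (hB : ∀ x x' y u u' v d i, g₁ x = some u → g₁ x' = some u' → g₂ y = some v →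
      gC u v = some d → gC u' v = some d → 0 < p (x i, y i) → 0 < p (x' i, y i) →
      f (x i) (y i) = f (x' i) (y i))
    (s : (Fin n → 𝒳) → (Fin n → 𝒴) → ℝ) (hs1 : ∀ x y, s x y ≤ 1)
    (hs0 : ∀ x y, 0 < s x y → ∃ u v d, g₁ x = some u ∧ g₂ y = some v ∧ gC u v = some d)
    {δ : ℝ}
    (hs : 1 - δ ≤ ∑ x : Fin n → 𝒳, ∑ y : Fin n → 𝒴, (∏ i, p (x i, y i)) * s x y) :
    ∃ S : Scheme 𝒳 𝒴 𝒵 n, S.IsPrefixFree ∧ S.IsUnrestricted p f ∧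
      S.rateA p ≤ 1 / n * (Nat.clog 2 C₁.card + 1 + δ * (n * Fintype.card 𝒳 + 1)) ∧
      S.rateB p ≤ 1 / n * (Nat.clog 2 C₂.card + 1 + δ * (n * Fintype.card 𝒴 + 1)) ∧
      S.rateC p ≤ 1 / n * (Nat.clog 2 (Fintype.card D) + 1 +
        δ * (n * (Fintype.card 𝒳 + Fintype.card 𝒴) + 1)) := by
  classical
  -- On failure, the sequence of singletons {x_i} is sent. Singletons are independent sets, so
  -- `vA_spec` holds in both cases and the relay treats both kinds of message alike.
  have exA : ∀ x, ∃ m : C₁ ⊕ (Fin n → Finset 𝒳),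
      (∀ u, g₁ x = some u → ∃ h, m = Sum.inl ⟨u, h⟩) ∧
      (g₁ x = none → m = Sum.inr fun i => {x i}) := by
    intro x
    rcases h : g₁ x with _ | u
    · exact ⟨_, by simp, fun _ => rfl⟩
    · exact ⟨Sum.inl ⟨u, (h₁ x u h).1⟩, fun u' hu => by cases hu; exact ⟨_, rfl⟩, by simp⟩
  have exB : ∀ y, ∃ m : C₂ ⊕ (Fin n → Finset 𝒴),
      (∀ u, g₂ y = some u → ∃ h, m = Sum.inl ⟨u, h⟩) ∧
      (g₂ y = none → m = Sum.inr fun i => {y i}) := by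
    intro y
    rcases h : g₂ y with _ | u
    · exact ⟨_, by simp, fun _ => rfl⟩
    · exact ⟨Sum.inl ⟨u, (h₂ y u h).1⟩, fun u' hu => by cases hu; exact ⟨_, rfl⟩, by simp⟩
  choose a ha ha' using exA
  choose b hb hb' using exB
  let vA : C₁ ⊕ (Fin n → Finset 𝒳) → Fin n → Finset 𝒳 := Sum.elim Subtype.val id
  let vB : C₂ ⊕ (Fin n → Finset 𝒴) → Fin n → Finset 𝒴 := Sum.elim Subtype.val id
  have vA_spec : ∀ x i, x i ∈ vA (a x) i ∧ (confGraphX p f).IsIndepSet (vA (a x) i : Set 𝒳) := by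
    intro x i
    rcases h : g₁ x with _ | u
    · rw [ha' x h]; simp [vA]
    · obtain ⟨_, e⟩ := ha x u h
      rw [e]; exact (h₁ x u h).2 i
  have vB_spec : ∀ y i, y i ∈ vB (b y) i ∧ (confGraphY p f).IsIndepSet (vB (b y) i : Set 𝒴) := by
    intro y i
    rcases h : g₂ y with _ | u
    · rw [hb' y h]; simp [vB]
    · obtain ⟨_, e⟩ := hb y u h
      rw [e]; exact (h₂ y u h).2 i
  have a_inl : ∀ x u, a x = Sum.inl u → g₁ x = some u.1 := by
    intro x u hu
    rcases h : g₁ x with _ | u'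
    · rw [ha' x h] at hu; cases hu
    · obtain ⟨_, e⟩ := ha x u' h
      rw [e] at hu; cases hu; rfl
  have b_inl : ∀ y u, b y = Sum.inl u → g₂ y = some u.1 := by
    intro y u hu
    rcases h : g₂ y with _ | u'
    · rw [hb' y h] at hu; cases hu
    · obtain ⟨_, e⟩ := hb y u' h
      rw [e] at hu; cases hu; rfl
  -- The short message is used only if both inputs are codewords and `gC` is defined; otherwise both
  -- set sequences are forwarded verbatim.
  let c : C₁ ⊕ (Fin n → Finset 𝒳) → C₂ ⊕ (Fin n → Finset 𝒴) →
      D ⊕ ((Fin n → Finset 𝒳) × (Fin n → Finset 𝒴)) := fun mA mB =>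
    Sum.elim (fun u => Sum.elim (fun v => (gC u.1 v.1).elim (Sum.inr (u.1, v.1)) Sum.inl)
      (fun v => Sum.inr (u.1, v)) mB) (fun u => Sum.inr (u, vB mB)) mA
  have c_inl : ∀ mA mB d, c mA mB = Sum.inl d →
      ∃ u v, mA = Sum.inl u ∧ mB = Sum.inl v ∧ gC u.1 v.1 = some d := by
    rintro (u | u) (v | v) d h
    · refine ⟨u, v, rfl, rfl, ?_⟩
      rcases e : gC u.1 v.1 with _ | d'
      · simp [c, e] at h
      · simp only [c, Sum.elim_inl, e, Option.elim_some, Sum.inl.injEq] at h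
        rw [h]
    · simp [c] at h
    · simp [c] at h
    · simp [c] at h
  have c_inr : ∀ mA mB w, c mA mB = Sum.inr w → w = (vA mA, vB mB) := by
    rintro (u | u) (v | v) w h
    · rcases e : gC u.1 v.1 with _ | d'
      · simp only [c, Sum.elim_inl, e, Option.elim_none, Sum.inr.injEq] at h
        rw [← h]; rfl
      · simp [c, e] at h
    · simp only [c, Sum.elim_inl, Sum.elim_inr, Sum.inr.injEq] at h
      rw [← h]; rfl
    · simp only [c, Sum.elim_inr, Sum.inr.injEq] at h
      rw [← h]; rfl
    · simp only [c, Sum.elim_inr, Sum.inr.injEq] at h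
      rw [← h]; rfl
  have indX : ∀ (w : Finset 𝒳) x x' y, (confGraphX p f).IsIndepSet (w : Set 𝒳) → x ∈ w → x' ∈ w →
      0 < p (x, y) → 0 < p (x', y) → f x y = f x' y := by
    intro w x x' y hw hx hx' h h'
    by_contra hne
    exact hw hx hx' (fun e => hne (by rw [e])) ⟨y, h, h', hne⟩
  have indY : ∀ (w : Finset 𝒴) x y y', (confGraphY p f).IsIndepSet (w : Set 𝒴) → y ∈ w → y' ∈ w →
      0 < p (x, y) → 0 < p (x, y') → f x y = f x y' := by
    intro w x y y' hw hx hx' h h'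
    by_contra hne
    exact hw hx hx' (fun e => hne (by rw [e])) ⟨x, h, h', hne⟩
  -- A short relay message is handled by the hypotheses `hA`, `hB`. A long one reveals the other
  -- node's set sequence, and both candidate inputs lie in it coordinatewise, so independence gives
  -- equal values of f.
  obtain ⟨S, hS1, hS2, lA, lB, lC⟩ := exists_scheme p f a b c (by
    intro x y y' i he hy hy'
    rcases hm : c (a x) (b y) with d | w
    · obtain ⟨u, v, e1, e2, e3⟩ := c_inl _ _ _ hm
      obtain ⟨u', v', e1', e2', e3'⟩ := c_inl _ _ _ (he.symm.trans hm)
      rw [e1] at e1'; cases e1'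
      exact hA x y y' u.1 v.1 v'.1 d i (a_inl _ _ e1) (b_inl _ _ e2) (b_inl _ _ e2') e3 e3' hy hy'
    · have e1 := c_inr _ _ _ hm
      have e2 := c_inr _ _ _ (he.symm.trans hm)
      have e : vB (b y) = vB (b y') := (Prod.ext_iff.mp (e1.symm.trans e2)).2
      exact indY _ _ _ _ (vB_spec y i).2 (vB_spec y i).1 (e ▸ (vB_spec y' i).1) hy hy') (by
    intro x x' y i he hy hy'
    rcases hm : c (a x) (b y) with d | w
    · obtain ⟨u, v, e1, e2, e3⟩ := c_inl _ _ _ hm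
      obtain ⟨u', v', e1', e2', e3'⟩ := c_inl _ _ _ (he.symm.trans hm)
      rw [e2] at e2'; cases e2'
      exact hB x x' y u.1 u'.1 v.1 d i (a_inl _ _ e1) (a_inl _ _ e1') (b_inl _ _ e2) e3 e3' hy hy'
    · have e1 := c_inr _ _ _ hm
      have e2 := c_inr _ _ _ (he.symm.trans hm)
      have e : vA (a x) = vA (a x') := (Prod.ext_iff.mp (e1.symm.trans e2)).1
      exact indX _ _ _ _ (vA_spec x i).2 (vA_spec x i).1 (e ▸ (vA_spec x' i).1) hy hy')
  -- The added 1 is the flag bit. When `s x y ≤ 0` the right side is at least the sum of both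
  -- possible lengths.
  have bound : ∀ (k K l : ℕ) (x : Fin n → 𝒳) (y : Fin n → 𝒴),
      (l = k + 1 ∨ l = K + 1) → (0 < s x y → l = k + 1) →
      (l : ℝ) ≤ (k : ℝ) + 1 + (1 - s x y) * ((K : ℝ) + 1) := by
    intro k K l x y hl hm
    have hK : (0 : ℝ) ≤ (K : ℝ) + 1 := by positivity
    have hk : (0 : ℝ) ≤ (k : ℝ) + 1 := by positivity
    have h0 := mul_nonneg (sub_nonneg.mpr (hs1 x y)) hK
    rcases lt_or_ge 0 (s x y) with h | h
    · rw [hm h]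
      push_cast
      linarith
    · have : 1 * ((K : ℝ) + 1) ≤ (1 - s x y) * ((K : ℝ) + 1) :=
        mul_le_mul_of_nonneg_right (by linarith) hK
      rcases hl with rfl | rfl
      · push_cast
        linarith
      · push_cast
        linarith
  refine ⟨S, hS1, hS2, mul_le_mul_of_nonneg_left ?_ (by positivity),
    mul_le_mul_of_nonneg_left ?_ (by positivity), mul_le_mul_of_nonneg_left ?_ (by positivity)⟩
  · simp only [← sum_prod_margX, Finset.sum_mul]
    have := expect_length_le hp s hs (fun x _ => ((S.encA x).length : ℝ))
      (Nat.clog 2 C₁.card + 1) (n * Fintype.card 𝒳 + 1) (by positivity) (fun x y => by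
        rw [lA, clog_card_finset_pi, Fintype.card_coe]
        have := bound (Nat.clog 2 C₁.card) (n * Fintype.card 𝒳) _ x y
          (sumElim_const_eq_or _ _ (a x)) (fun h => by
          obtain ⟨u, v, d, h1, -⟩ := hs0 x y h
          obtain ⟨_, e⟩ := ha x u h1
          rw [e, Sum.elim_inl])
        push_cast at this ⊢
        exact this)
    exact this
  · simp only [← sum_prod_margY, Finset.sum_mul]
    rw [Finset.sum_comm]
    have := expect_length_le hp s hs (fun _ y => ((S.encB y).length : ℝ))
      (Nat.clog 2 C₂.card + 1) (n * Fintype.card 𝒴 + 1) (by positivity) (fun x y => by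
        rw [lB, clog_card_finset_pi, Fintype.card_coe]
        have := bound (Nat.clog 2 C₂.card) (n * Fintype.card 𝒴) _ x y
          (sumElim_const_eq_or _ _ (b y)) (fun h => by
          obtain ⟨u, v, d, -, h1, -⟩ := hs0 x y h
          obtain ⟨_, e⟩ := hb y v h1
          rw [e, Sum.elim_inl])
        push_cast at this ⊢
        exact this)
    exact this
  · refine expect_length_le hp s hs (fun x y => ((S.msgC x y).length : ℝ))
      (Nat.clog 2 (Fintype.card D) + 1) (n * (Fintype.card 𝒳 + Fintype.card 𝒴) + 1)
      (by positivity) (fun x y => ?_)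
    have hcard : Nat.clog 2 (Fintype.card ((Fin n → Finset 𝒳) × (Fin n → Finset 𝒴)))
        = n * (Fintype.card 𝒳 + Fintype.card 𝒴) := by
      rw [Fintype.card_prod, Fintype.card_fun, Fintype.card_fun, Fintype.card_finset,
        Fintype.card_finset, Fintype.card_fin, ← pow_mul, ← pow_mul, ← pow_add,
        Nat.clog_pow _ _ one_lt_two]
      ring
    rw [lC, hcard]
    have := bound (Nat.clog 2 (Fintype.card D)) (n * (Fintype.card 𝒳 + Fintype.card 𝒴))
      _ x y (sumElim_const_eq_or _ _ (c (a x) (b y)))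
      (fun h => by
        obtain ⟨u, v, d, h1, h2, h3⟩ := hs0 x y h
        obtain ⟨_, e1⟩ := ha x u h1
        obtain ⟨_, e2⟩ := hb y v h2
        simp [c, e1, e2, h3])
    push_cast at this ⊢
    exact this

end

/-! ### From coverings to achievable triples -/

theorem clog_le_of_card_le {c : ℕ} {r : ℝ} (hr : 0 ≤ r) (h : (c : ℝ) ≤ (2 : ℝ) ^ r) :
    (Nat.clog 2 c : ℝ) ≤ r + 1 := by
  have h1 : c ≤ 2 ^ ⌈r⌉₊ := by
    have : (2 : ℝ) ^ r ≤ (2 : ℝ) ^ (⌈r⌉₊ : ℝ) :=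
      Real.rpow_le_rpow_of_exponent_le one_le_two (Nat.le_ceil r)
    rw [Real.rpow_natCast] at this
    exact_mod_cast h.trans this
  calc (Nat.clog 2 c : ℝ) ≤ (⌈r⌉₊ : ℝ) := by exact_mod_cast Nat.clog_le_of_le_pow h1
    _ ≤ r + 1 := (Nat.ceil_lt_add_one hr).le

/-- Budget for ε: a quarter for the codebook exponent, a quarter for failures, and half for the two
extra bits (rounding and flag), since 2 ≤ nε/2. -/
theorem rate_le {n : ℕ} {k R ε δ L : ℝ} (hδ : 0 ≤ δ) (hn1 : 1 ≤ n) (hn : 4 / ε ≤ n)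
    (hε : 0 < ε) (hk : k ≤ n * (R + ε / 4) + 1) (hδL : δ * (L + 1) ≤ ε / 4) :
    1 / (n : ℝ) * (k + 1 + δ * (n * L + 1)) ≤ R + ε := by
  have hn' : (1 : ℝ) ≤ n := by exact_mod_cast hn1
  rw [one_div, inv_mul_le_iff₀ (by linarith)]
  rw [div_le_iff₀ hε] at hn
  nlinarith [mul_le_mul_of_nonneg_left hδL (by linarith : (0 : ℝ) ≤ n), mul_le_mul_of_nonneg_left hn' hδ]

theorem sum_partialKernel_mul {V W : Type*} [Fintype W] (g : V → Option W) (v : V) (F : W → ℝ) :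
    ∑ w, partialKernel g v w * F w = (g v).elim 0 F := by
  classical
  unfold partialKernel
  rcases g v with _ | w <;> simp

/-- The indicator of the event that three partial functions in a chain are defined. -/
theorem sum_partialKernel_chain {X Y U₁ U₂ V W : Type*} [Fintype U₁] [Fintype U₂] [Fintype W]
    (g₁ : X → Option U₁) (g₂ : Y → Option U₂) (g₃ : V → Option W) (m : U₁ → U₂ → V) (x : X)
    (y : Y) :
    ∑ u₁, ∑ u₂, ∑ w, partialKernel g₁ x u₁ * partialKernel g₂ y u₂ * partialKernel g₃ (m u₁ u₂) w
      = (g₁ x).elim 0 fun u₁ => (g₂ y).elim 0 fun u₂ => (g₃ (m u₁ u₂)).elim 0 fun _ => 1 := by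
  simp only [← sum_partialKernel_mul, Finset.mul_sum, mul_one, mul_assoc]

section
variable {𝒳 : Type u} {𝒴 : Type v} {𝒵 : Type w} [Fintype 𝒳] [Fintype 𝒴]

/-- A scheme for each large block length, built from coverings, makes a triple achievable. The
relay's compressed message is described by `relay`. -/
theorem isAchievable_of_relay [Nonempty 𝒵] {p : 𝒳 × 𝒴 → ℝ} (hp : p ∈ stdSimplex ℝ (𝒳 × 𝒴))
    (f : 𝒳 → 𝒴 → 𝒵) {W : Type*} [Fintype W] {κ₁ : 𝒳 → Finset 𝒳 → ℝ} {κ₂ : 𝒴 → Finset 𝒴 → ℝ}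
    {κW : Finset 𝒳 × Finset 𝒴 → W → ℝ} (h₁ : IsIndepChannel (confGraphX p f) κ₁)
    (h₂ : IsIndepChannel (confGraphY p f) κ₂) (hW : IsChannel κW) (RC : ℝ)
    (relay : ∀ ε : ℝ, 0 < ε → ∀ n : ℕ, 1 ≤ n →
      ∀ (C₁ : Finset (Fin n → Finset 𝒳)) (C₂ : Finset (Fin n → Finset 𝒴))
        (C₃ : Finset (Fin n → W)) (g₃ : (Fin n → Finset 𝒳 × Finset 𝒴) → Option (Fin n → W)),
      (C₁.card : ℝ) ≤ 2 ^ ((n : ℝ) * (mutualInfo (jointPmf (margX p) κ₁) + ε)) →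
      (C₂.card : ℝ) ≤ 2 ^ ((n : ℝ) * (mutualInfo (jointPmf (margY p) κ₂) + ε)) →
      (C₃.card : ℝ) ≤ 2 ^ ((n : ℝ) * (mutualInfo (jointPmf (pairPmf p κ₁ κ₂) κW) + ε)) →
      (∀ v w, g₃ v = some w → w ∈ C₃ ∧ ∀ i, 0 < κW (v i) (w i)) →
      ∃ (k : ℕ) (gC : (Fin n → Finset 𝒳) → (Fin n → Finset 𝒴) → Option (Fin k → Bool)),
        (k : ℝ) ≤ n * (RC + ε) + 1 ∧
        (∀ u v w, g₃ (fun i => (u i, v i)) = some w → (gC u v).isSome) ∧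
        (∀ (x : Fin n → 𝒳) (y y' : Fin n → 𝒴) u v v' d i, (∀ i, 0 < κ₁ (x i) (u i)) → (∀ i, 0 < κ₂ (y i) (v i)) →
          (∀ i, 0 < κ₂ (y' i) (v' i)) → u ∈ C₁ → v ∈ C₂ → v' ∈ C₂ → gC u v = some d →
          gC u v' = some d → 0 < p (x i, y i) → 0 < p (x i, y' i) →
          f (x i) (y i) = f (x i) (y' i)) ∧
        (∀ (x x' : Fin n → 𝒳) (y : Fin n → 𝒴) u u' v d i, (∀ i, 0 < κ₁ (x i) (u i)) → (∀ i, 0 < κ₁ (x' i) (u' i)) →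
          (∀ i, 0 < κ₂ (y i) (v i)) → u ∈ C₁ → u' ∈ C₁ → v ∈ C₂ → gC u v = some d →
          gC u' v = some d → 0 < p (x i, y i) → 0 < p (x' i, y i) →
          f (x i) (y i) = f (x' i) (y i))) :
    IsAchievable p f (mutualInfo (jointPmf (margX p) κ₁), mutualInfo (jointPmf (margY p) κ₂), RC) := by
  intro ε hε
  set L : ℝ := (Fintype.card 𝒳 : ℝ) + Fintype.card 𝒴 with hL
  have hL0 : 0 ≤ L := by positivity
  -- The longest uncompressed message is the relay's, of nL + 1 bits; with this δ it costs at most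
  -- ε/4 per letter on average.
  set δ : ℝ := ε / 4 / (L + 1) with hδdef
  have hδ : 0 < δ := by positivity
  have hδL : δ * (L + 1) ≤ ε / 4 := by rw [hδdef, div_mul_cancel₀ _ (by positivity)]
  have hδX : δ * ((Fintype.card 𝒳 : ℝ) + 1) ≤ ε / 4 :=
    (mul_le_mul_of_nonneg_left (by simp [hL]) hδ.le).trans hδL
  have hδY : δ * ((Fintype.card 𝒴 : ℝ) + 1) ≤ ε / 4 :=
    (mul_le_mul_of_nonneg_left (by simp [hL]) hδ.le).trans hδL
  have hε4 : 0 < ε / 4 := by positivity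
  have i1 := mutualInfo_nonneg (margX_mem hp) h₁.1
  have i2 := mutualInfo_nonneg (margY_mem hp) h₂.1
  filter_upwards [eventually_exists_covers hp h₁.1 h₂.1 hW hε4 hδ,
    eventually_ge_atTop 1, eventually_ge_atTop ⌈4 / ε⌉₊] with n hcov hn1 hn
  have hn' : 4 / ε ≤ n := Nat.ceil_le.mp hn
  obtain ⟨g₁, g₂, g₃, C₁, C₂, C₃, k1, k2, k3, s1, s2, s3, hS⟩ := hcov
  obtain ⟨k, gC, hk, hg, hA, hB⟩ := relay (ε / 4) hε4 n hn1 C₁ C₂ C₃ g₃ k1 k2 k3 s3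
  obtain ⟨S, hpf, hun, hRA, hRB, hRC⟩ := exists_scheme_of_covers hp f g₁ C₁ g₂ C₂ gC
    (fun x u h => ⟨(s1 x u h).1, fun i => h₁.2 _ _ ((s1 x u h).2 i)⟩)
    (fun y u h => ⟨(s2 y u h).1, fun i => h₂.2 _ _ ((s2 y u h).2 i)⟩)
    (fun x y y' u v v' d i a b b' => hA x y y' u v v' d i (s1 x u a).2 (s2 y v b).2
      (s2 y' v' b').2 (s1 x u a).1 (s2 y v b).1 (s2 y' v' b').1)
    (fun x x' y u u' v d i a a' b => hB x x' y u u' v d i (s1 x u a).2 (s1 x' u' a').2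
      (s2 y v b).2 (s1 x u a).1 (s1 x' u' a').1 (s2 y v b).1)
    (fun x y => ∑ u₁, ∑ u₂, ∑ w, partialKernel g₁ x u₁ * partialKernel g₂ y u₂ *
          partialKernel g₃ (fun i => (u₁ i, u₂ i)) w)
    (fun x y => by
      rw [sum_partialKernel_chain g₁ g₂ g₃ fun u₁ u₂ i => (u₁ i, u₂ i)]
      rcases g₁ x with _ | u
      · simp
      rcases g₂ y with _ | v
      · simp
      rcases h : g₃ (fun i => (u i, v i)) with _ | w <;> simp [h])
    (fun x y hpos => by
      rw [sum_partialKernel_chain g₁ g₂ g₃ fun u₁ u₂ i => (u₁ i, u₂ i)] at hpos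
      rcases h1 : g₁ x with _ | u
      · simp [h1] at hpos
      rcases h2 : g₂ y with _ | v
      · simp [h1, h2] at hpos
      rcases h3 : g₃ (fun i => (u i, v i)) with _ | w
      · simp [h1, h2, h3] at hpos
      obtain ⟨d, hd⟩ := Option.isSome_iff_exists.mp (hg u v w h3)
      exact ⟨u, v, d, rfl, rfl, hd⟩) hS
  refine ⟨S, hpf, hun, hRA.trans ?_, hRB.trans ?_, hRC.trans ?_⟩
  · exact rate_le hδ.le hn1 hn' hε (clog_le_of_card_le (by positivity) k1) hδX
  · exact rate_le hδ.le hn1 hn' hε (clog_le_of_card_le (by positivity) k2) hδY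
  · refine rate_le hδ.le hn1 hn' hε ?_ hδL
    simpa [Nat.clog_pow] using hk

/-- For fixed test channels, the corner point of `R_{I1}` is achievable. -/
theorem isAchievable_regionI1 [Nonempty 𝒵] {p : 𝒳 × 𝒴 → ℝ} (hp : p ∈ stdSimplex ℝ (𝒳 × 𝒴))
    (f : 𝒳 → 𝒴 → 𝒵) {κ₁ : 𝒳 → Finset 𝒳 → ℝ} {κ₂ : 𝒴 → Finset 𝒴 → ℝ}
    {κW : Finset 𝒳 × Finset 𝒴 → Finset (Finset 𝒳 × Finset 𝒴) → ℝ}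
    (h₁ : IsIndepChannel (confGraphX p f) κ₁) (h₂ : IsIndepChannel (confGraphY p f) κ₂)
    (hW : IsIndepChannel (auxGraph p f κ₁ κ₂) κW) :
    IsAchievable p f (mutualInfo (jointPmf (margX p) κ₁), mutualInfo (jointPmf (margY p) κ₂),
      mutualInfo (jointPmf (pmfUU p κ₁ κ₂) κW)) := by
  classical
  change IsAchievable p f (_, _, mutualInfo (jointPmf (pairPmf p κ₁ κ₂) κW))
  refine isAchievable_of_relay hp f h₁ h₂ hW.1 _ ?_
  intro ε hε n hn C₁ C₂ C₃ g₃ _ _ k3 s3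
  have i3 := mutualInfo_nonneg (pairPmf_mem hp h₁.1 h₂.1) hW.1
  obtain ⟨e⟩ := nonempty_embedding_bits C₃
  rw [Fintype.card_coe] at e
  have hex : ∀ v, ∃ o : Option C₃, o.map Subtype.val = g₃ v := by
    intro v
    rcases h : g₃ v with _ | w
    · exact ⟨none, rfl⟩
    · exact ⟨some ⟨w, (s3 v w h).1⟩, rfl⟩
  choose o ho using hex
  -- Equal relay messages mean the same codeword of `C₃`, hence in each coordinate one independent
  -- set containing both pairs.
  have key : ∀ (u : Fin n → Finset 𝒳) (v : Fin n → Finset 𝒴) (u' : Fin n → Finset 𝒳)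
      (v' : Fin n → Finset 𝒴) d, (o fun i => (u i, v i)).map e = some d →
      (o fun i => (u' i, v' i)).map e = some d →
      ∃ w : Fin n → Finset (Finset 𝒳 × Finset 𝒴), ∀ i,
        ((u i, v i) ∈ w i ∧ (u' i, v' i) ∈ w i) ∧
          (auxGraph p f κ₁ κ₂).IsIndepSet (w i : Set (Finset 𝒳 × Finset 𝒴)) := by
    intro u v u' v' d h h'
    obtain ⟨c, hc, rfl⟩ := Option.map_eq_some_iff.mp h
    obtain ⟨c', hc', hcc⟩ := Option.map_eq_some_iff.mp h'
    have hcc := e.injective hcc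
    subst hcc
    have g1 := ho fun i => (u i, v i)
    have g2 := ho fun i => (u' i, v' i)
    rw [hc] at g1
    rw [hc'] at g2
    refine ⟨c'.1, fun i => ?_⟩
    have a := hW.2 _ _ ((s3 _ _ g1.symm).2 i)
    have b := hW.2 _ _ ((s3 _ _ g2.symm).2 i)
    exact ⟨⟨a.1, b.1⟩, a.2⟩
  refine ⟨_, fun u v => (o fun i => (u i, v i)).map e, clog_le_of_card_le (by positivity) k3,
    ?_, ?_, ?_⟩
  · intro u v w h
    rw [← ho] at h
    obtain ⟨c, hc, -⟩ := Option.map_eq_some_iff.mp h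
    simp [hc]
  · intro x y y' u v v' d i hx hy hy' _ _ _ hd hd' hp1 hp2
    obtain ⟨w, hw⟩ := key _ _ _ _ _ hd hd'
    by_contra hne
    have j1 : 0 < jointXUYU p κ₁ κ₂ (x i) (u i) (y i) (v i) := mul_pos (mul_pos hp1 (hx i)) (hy i)
    have j2 : 0 < jointXUYU p κ₁ κ₂ (x i) (u i) (y' i) (v' i) :=
      mul_pos (mul_pos hp2 (hx i)) (hy' i)
    -- `auxGraph` has no loops, so it says nothing when the two pairs coincide. Then y_i and y'_i
    -- lie in the same independent set of `confGraphY`, which settles the case.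
    by_cases hv : v i = v' i
    · have a := h₂.2 _ _ (hy i)
      have b := h₂.2 _ _ (hy' i)
      rw [← hv] at b
      exact a.2 a.1 b.1 (fun e => hne (by rw [e])) ⟨_, hp1, hp2, hne⟩
    · have huv : (u i, v i) ≠ (u i, v' i) := fun e => hv (Prod.ext_iff.mp e).2
      exact (hw i).2 (hw i).1.1 (hw i).1.2 huv
        ⟨huv, _, _, _, _, j1, j2, Or.inl ⟨rfl, rfl, hne⟩⟩
  · intro x x' y u u' v d i hx hx' hy _ _ _ hd hd' hp1 hp2
    obtain ⟨w, hw⟩ := key _ _ _ _ _ hd hd'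
    by_contra hne
    have j1 : 0 < jointXUYU p κ₁ κ₂ (x i) (u i) (y i) (v i) := mul_pos (mul_pos hp1 (hx i)) (hy i)
    have j2 : 0 < jointXUYU p κ₁ κ₂ (x' i) (u' i) (y i) (v i) :=
      mul_pos (mul_pos hp2 (hx' i)) (hy i)
    by_cases hv : u i = u' i
    · have a := h₁.2 _ _ (hx i)
      have b := h₁.2 _ _ (hx' i)
      rw [← hv] at b
      exact a.2 a.1 b.1 (fun e => hne (by rw [e])) ⟨_, hp1, hp2, hne⟩
    · have huv : (u i, v i) ≠ (u' i, v i) := fun e => hv (Prod.ext_iff.mp e).1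
      exact (hw i).2 (hw i).1.1 (hw i).1.2 huv
        ⟨huv, _, _, _, _, j1, j2, Or.inr ⟨rfl, rfl, hne⟩⟩

/-- The free length `k` allows two codebooks of different sizes to be labelled by words of equal
length, as a bitwise XOR requires. -/
theorem exists_injOn_bits {α : Type*} (C : Finset α) {k : ℕ} (hC : Nat.clog 2 C.card ≤ k) :
    ∃ e : α → (Fin k → Bool), Set.InjOn e C := by
  classical
  obtain ⟨e⟩ : Nonempty (C ↪ (Fin k → Bool)) := by
    apply Function.Embedding.nonempty_of_card_le
    simpa using (Nat.le_pow_clog one_lt_two C.card).trans (Nat.pow_le_pow_right two_pos hC)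
  refine ⟨fun a => if h : a ∈ C then e ⟨a, h⟩ else fun _ => false, fun a ha b hb h => ?_⟩
  have ha' : a ∈ C := ha
  have hb' : b ∈ C := hb
  simp only [ha', hb', dif_pos] at h
  exact congrArg Subtype.val (e.injective h)

/-- For fixed test channels, the relay can broadcast the sum of the two messages. -/
theorem isAchievable_regionI2 [Nonempty 𝒵] {p : 𝒳 × 𝒴 → ℝ} (hp : p ∈ stdSimplex ℝ (𝒳 × 𝒴))
    (f : 𝒳 → 𝒴 → 𝒵) {κ₁ : 𝒳 → Finset 𝒳 → ℝ} {κ₂ : 𝒴 → Finset 𝒴 → ℝ}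
    (h₁ : IsIndepChannel (confGraphX p f) κ₁) (h₂ : IsIndepChannel (confGraphY p f) κ₂) :
    IsAchievable p f (mutualInfo (jointPmf (margX p) κ₁), mutualInfo (jointPmf (margY p) κ₂),
      max (mutualInfo (jointPmf (margX p) κ₁)) (mutualInfo (jointPmf (margY p) κ₂))) := by
  classical
  have i1 := mutualInfo_nonneg (margX_mem hp) h₁.1
  have i2 := mutualInfo_nonneg (margY_mem hp) h₂.1
  -- The relay covers nothing here, so its test channel is trivial.
  refine isAchievable_of_relay hp f (W := Unit) (κW := fun _ _ => 1) h₁ h₂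
    (fun _ => ⟨fun _ => zero_le_one, by simp⟩) _ ?_
  intro ε hε n hn C₁ C₂ C₃ g₃ k1 k2 _ _
  set k := max (Nat.clog 2 C₁.card) (Nat.clog 2 C₂.card) with hk
  obtain ⟨e₁, he₁⟩ := exists_injOn_bits C₁ (le_max_left _ _ : _ ≤ k)
  obtain ⟨e₂, he₂⟩ := exists_injOn_bits C₂ (le_max_right _ _ : _ ≤ k)
  refine ⟨k, fun u v => some fun j => xor (e₁ u j) (e₂ v j), ?_, fun _ _ _ _ => rfl, ?_, ?_⟩
  · rw [hk, Nat.cast_max]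
    refine max_le ((clog_le_of_card_le (by positivity) k1).trans ?_)
      ((clog_le_of_card_le (by positivity) k2).trans ?_)
    · gcongr; exact le_max_left _ _
    · gcongr; exact le_max_right _ _
  -- A knows `u`, so cancelling its label from the XOR determines `v`.
  · intro x y y' u v v' d i hx hy hy' _ hv hv' hd hd' hp1 hp2
    have hvv : v = v' := he₂ hv hv' (funext fun j => by
      have := congrFun (Option.some_injective _ (hd.trans hd'.symm)) j
      simpa using this)
    subst hvv
    by_contra hne
    have a := h₂.2 _ _ (hy i)
    exact a.2 a.1 (h₂.2 _ _ (hy' i)).1 (fun e => hne (by rw [e])) ⟨_, hp1, hp2, hne⟩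
  · intro x x' y u u' v d i hx hx' hy hv hv' _ hd hd' hp1 hp2
    have hvv : u = u' := he₁ hv hv' (funext fun j => by
      have := congrFun (Option.some_injective _ (hd.trans hd'.symm)) j
      simpa using this)
    subst hvv
    by_contra hne
    have a := h₁.2 _ _ (hx i)
    exact a.2 a.1 (h₁.2 _ _ (hx' i)).1 (fun e => hne (by rw [e])) ⟨_, hp1, hp2, hne⟩

theorem IsAchievable.mono {p : 𝒳 × 𝒴 → ℝ} {f : 𝒳 → 𝒴 → 𝒵} {R R' : ℝ × ℝ × ℝ}
    (h : IsAchievable p f R) (hR : R ≤ R') : IsAchievable p f R' := by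
  intro ε hε
  filter_upwards [h ε hε] with n hn
  obtain ⟨S, h1, h2, h3, h4, h5⟩ := hn
  exact ⟨S, h1, h2, h3.trans (add_le_add_left hR.1 _), h4.trans (add_le_add_left hR.2.1 _),
    h5.trans (add_le_add_left hR.2.2 _)⟩

/-- With this, near-optimal channels suffice for `regionI2`: attainment of the infimum in
`graphEntropy` is not needed. -/
theorem isAchievable_of_forall_add {p : 𝒳 × 𝒴 → ℝ} {f : 𝒳 → 𝒴 → 𝒵} {R : ℝ × ℝ × ℝ}
    (h : ∀ ε : ℝ, 0 < ε → IsAchievable p f (R + (ε, ε, ε))) : IsAchievable p f R := by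
  intro ε hε
  filter_upwards [h (ε / 2) (half_pos hε) (ε / 2) (half_pos hε)] with n hn
  obtain ⟨S, h1, h2, h3, h4, h5⟩ := hn
  refine ⟨S, h1, h2, h3.trans_eq ?_, h4.trans_eq ?_, h5.trans_eq ?_⟩ <;>
    simp only [Prod.fst_add, Prod.snd_add] <;> ring

theorem exists_isIndepChannel {V : Type*} [Fintype V] (G : SimpleGraph V) :
    ∃ κ : V → Finset V → ℝ, IsIndepChannel G κ := by
  classical
  refine ⟨fun v w => if w = {v} then 1 else 0, fun v => ⟨fun w => ?_, by simp⟩, fun v w h => ?_⟩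
  · dsimp only; split_ifs <;> norm_num
  · by_cases hw : w = {v}
    · subst hw; simp
    · simp [hw] at h

theorem exists_mutualInfo_lt {V : Type*} [Fintype V] (G : SimpleGraph V) (p : V → ℝ) {t : ℝ}
    (ht : graphEntropy G p < t) :
    ∃ κ : V → Finset V → ℝ, IsIndepChannel G κ ∧ mutualInfo (jointPmf p κ) < t := by
  obtain ⟨κ₀, h₀⟩ := exists_isIndepChannel G
  have hne : {t | ∃ κ : V → Finset V → ℝ, IsIndepChannel G κ ∧
      t = mutualInfo (jointPmf p κ)}.Nonempty := ⟨_, κ₀, h₀, rfl⟩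
  obtain ⟨_, ⟨κ, hκ, rfl⟩, hlt⟩ := exists_lt_of_csInf_lt hne ht
  exact ⟨κ, hκ, hlt⟩

theorem regionI2_subset [Nonempty 𝒵] {p : 𝒳 × 𝒴 → ℝ} (hp : p ∈ stdSimplex ℝ (𝒳 × 𝒴))
    (f : 𝒳 → 𝒴 → 𝒵) : regionI2 p f ⊆ {R | IsAchievable p f R} := by
  rintro R ⟨hA, hB, hC⟩
  refine isAchievable_of_forall_add fun ε hε => ?_
  obtain ⟨κ₁, h₁, l₁⟩ := exists_mutualInfo_lt (confGraphX p f) (margX p) (lt_add_of_pos_right _ hε)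
  obtain ⟨κ₂, h₂, l₂⟩ := exists_mutualInfo_lt (confGraphY p f) (margY p) (lt_add_of_pos_right _ hε)
  refine (isAchievable_regionI2 hp f h₁ h₂).mono ⟨?_, ?_, max_le ?_ ?_⟩
  · exact l₁.le.trans (add_le_add_left hA _)
  · exact l₂.le.trans (add_le_add_left hB _)
  · exact l₁.le.trans (add_le_add_left ((le_max_left _ _).trans hC) _)
  · exact l₂.le.trans (add_le_add_left ((le_max_right _ _).trans hC) _)

theorem regionI1_subset [Nonempty 𝒵] {p : 𝒳 × 𝒴 → ℝ} (hp : p ∈ stdSimplex ℝ (𝒳 × 𝒴))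
    (f : 𝒳 → 𝒴 → 𝒵) : regionI1 p f ⊆ convexHull ℝ {R | IsAchievable p f R} := by
  rintro R ⟨k, pQ, κ₁, κ₂, κW, hQ, h₁, h₂, hW, hA, hB, hC⟩
  set r : Fin k → ℝ × ℝ × ℝ := fun q => (mutualInfo (jointPmf (margX p) (κ₁ q)),
    mutualInfo (jointPmf (margY p) (κ₂ q)),
    mutualInfo (jointPmf (pmfUU p (κ₁ q) (κ₂ q)) (κW q))) with hr
  have hle : ∑ q, pQ q • r q ≤ R := by
    refine ⟨?_, ?_, ?_⟩
    · simpa [Prod.fst_sum, hr] using hA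
    · simpa [Prod.fst_sum, Prod.snd_sum, hr] using hB
    · simpa [Prod.snd_sum, hr] using hC
  -- The nonnegative slack is added in full to every corner point, so R is a convex combination of
  -- achievable triples.
  have hR : R = ∑ q, pQ q • (r q + (R - ∑ q, pQ q • r q)) := by
    simp only [smul_add, Finset.sum_add_distrib]
    rw [← Finset.sum_smul, hQ.2, one_smul, add_sub_cancel]
  rw [hR]
  refine (convex_convexHull ℝ _).sum_mem (fun q _ => hQ.1 q) hQ.2 fun q _ => subset_convexHull ℝ _ ?_
  exact (isAchievable_regionI1 hp f (h₁ q) (h₂ q) (hW q)).mono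
    (le_add_of_nonneg_right (sub_nonneg.mpr hle))

theorem convexClosure_subset_unrestrictedRegion {p : 𝒳 × 𝒴 → ℝ}
    (hp : p ∈ stdSimplex ℝ (𝒳 × 𝒴)) (f : 𝒳 → 𝒴 → 𝒵) :
    closure (convexHull ℝ (regionI1 p f ∪ regionI2 p f)) ⊆ unrestrictedRegion p f := by
  -- The decoders need a default value; a probability mass function forces the input alphabets,
  -- hence 𝒵, to be nonempty.
  have : Nonempty 𝒵 := by
    obtain ⟨a⟩ : Nonempty (𝒳 × 𝒴) := by
      by_contra h
      rw [not_nonempty_iff] at h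
      simpa using hp.2
    exact ⟨f a.1 a.2⟩
  exact closure_mono (convexHull_min (Set.union_subset (regionI1_subset hp f)
    ((regionI2_subset hp f).trans (subset_convexHull ℝ _))) (convex_convexHull ℝ _))

end

/-! ### Mutual information on either side of one bit; complete graphs -/

/-- The deterministic channel of a function. -/
noncomputable def detKernel {V W : Type*} (φ : V → W) (v : V) (w : W) : ℝ :=
  open Classical in if w = φ v then 1 else 0

theorem isChannel_detKernel {V W : Type*} [Fintype W] (φ : V → W) : IsChannel (detKernel φ) := by
  classical
  refine fun v => ⟨fun w => ?_, by simp [detKernel]⟩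
  unfold detKernel
  split_ifs <;> norm_num

theorem eq_of_detKernel_pos {V W : Type*} {φ : V → W} {v : V} {w : W} (h : 0 < detKernel φ v w) : w = φ v := by
  by_contra hne
  simp [detKernel, hne] at h

section
variable {V W : Type*} [Fintype V] [Fintype W]

/-- If the output determines an unbiased bit of the input, then the mutual information is at least
one bit. -/
theorem one_le_mutualInfo {P : V → ℝ} {κ : V → W → ℝ} (hP : P ∈ stdSimplex ℝ V)
    (hκ : IsChannel κ) (ψ : V → Prop) (φ : W → Prop) [DecidablePred ψ]
    (h : ∀ v w, 0 < P v → 0 < κ v w → (ψ v ↔ φ w))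
    (hψ : ∑ v, (if ψ v then P v else 0) = 1 / 2) : 1 ≤ mutualInfo (jointPmf P κ) := by
  classical
  have hψ' : ∑ v, (if ψ v then 0 else P v) = 1 / 2 := by
    have : ∑ v, (if ψ v then P v else 0) + ∑ v, (if ψ v then 0 else P v) = 1 := by
      rw [← Finset.sum_add_distrib, ← hP.2]
      exact Finset.sum_congr rfl fun v _ => by split_ifs <;> simp
    linarith
  have hpos : ∀ v w, 0 < P v * κ v w → (ψ v ↔ φ w) := fun v w hvw =>
    h v w ((pos_iff_pos_of_mul_pos hvw).2 (pos_of_mul_pos_right hvw (hP.1 v)))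
      (pos_of_mul_pos_right hvw (hP.1 v))
  -- If input and output were independent, an unbiased bit would agree with any output event with
  -- probability 1/2, so this function has mass exactly 1, while its logarithm is 1 almost surely
  -- under the true joint law.
  have key := le_mutualInfo hP hκ (fun v w => if (ψ v ↔ φ w) then 2 else 0)
    (fun v w => by split_ifs <;> norm_num) (fun v w hvw => by simp [hpos v w hvw]) (by
      rw [Finset.sum_comm, ← sum_outPmf hP hκ]
      refine Finset.sum_le_sum fun w _ => le_of_eq ?_
      have : ∀ v, P v * outPmf P κ w * (if (ψ v ↔ φ w) then 2 else 0)
          = 2 * outPmf P κ w * (if (ψ v ↔ φ w) then P v else 0) := by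
        intro v; split_ifs <;> ring
      simp only [this, ← Finset.mul_sum]
      by_cases hw : φ w
      · simp only [hw, iff_true, hψ]; ring
      · simp only [hw, iff_false, ite_not, hψ']; ring)
  refine le_trans (le_of_eq ?_) key
  have : ∀ v w, P v * κ v w * Real.logb 2 (if (ψ v ↔ φ w) then 2 else 0) = P v * κ v w := by
    intro v w
    rcases (mul_nonneg (hP.1 v) ((hκ v).1 w)).lt_or_eq with hvw | hvw
    · simp [hpos v w hvw]
    · simp [← hvw]
  simp only [this, ← Finset.mul_sum, (hκ _).2, mul_one, hP.2]

/-- A deterministic output that only tells whether an event of probability `1/4` occurs carries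
less than one bit. -/
theorem mutualInfo_detKernel_lt_one {P : V → ℝ} (hP : P ∈ stdSimplex ℝ V) (v₀ : V) (φ : V → W)
    (w₁ : W) (h₁ : ∀ v, v ≠ v₀ → φ v = w₁) (h₀ : φ v₀ ≠ w₁) (hv₀ : P v₀ = 1 / 4) :
    mutualInfo (jointPmf P (detKernel φ)) < 1 := by
  classical
  have hrest : ∑ v, (if v = v₀ then 0 else P v) = 3 / 4 := by
    have : ∑ v, (if v = v₀ then P v else 0) + ∑ v, (if v = v₀ then 0 else P v) = 1 := by
      rw [← Finset.sum_add_distrib, ← hP.2]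
      exact Finset.sum_congr rfl fun v _ => by split_ifs <;> simp
    rw [Finset.sum_ite_eq' Finset.univ v₀ P, if_pos (Finset.mem_univ _), hv₀] at this
    linarith
  have o₀ : outPmf P (detKernel φ) (φ v₀) = 1 / 4 := by
    unfold outPmf
    rw [← hv₀, Finset.sum_eq_single v₀]
    · simp [detKernel]
    · intro v _ hv
      simp [detKernel, h₁ v hv, h₀]
    · simp
  have o₁ : outPmf P (detKernel φ) w₁ = 3 / 4 := by
    unfold outPmf
    rw [← hrest]
    refine Finset.sum_congr rfl fun v _ => ?_
    split_ifs with hv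
    · simp [detKernel, hv, h₀.symm]
    · simp [detKernel, h₁ v hv]
  have hI : mutualInfo (jointPmf P (detKernel φ))
      = ∑ v, ((if v = v₀ then P v else 0) * Real.logb 2 4 +
          (if v = v₀ then 0 else P v) * Real.logb 2 (4 / 3)) := by
    rw [mutualInfo_jointPmf (isChannel_detKernel φ)]
    refine Finset.sum_congr rfl fun v _ => ?_
    rw [Finset.sum_eq_single (φ v)]
    · split_ifs with hv
      · subst hv
        rw [o₀]
        norm_num [detKernel]
      · rw [h₁ v hv, o₁]
        norm_num [detKernel, h₁ v hv]
    · intro w _ hw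
      simp [detKernel, hw]
    · simp
  rw [hI, Finset.sum_add_distrib, ← Finset.sum_mul, ← Finset.sum_mul, hrest,
    Finset.sum_ite_eq' Finset.univ v₀ P, if_pos (Finset.mem_univ _), hv₀]
  have e4 : Real.logb 2 4 = 2 := by
    rw [show (4 : ℝ) = 2 ^ (2 : ℝ) by norm_num, Real.logb_rpow two_pos (by norm_num)]
  -- This is what (1/4)·2 + (3/4)·log₂(4/3) < 1 requires; cubing reduces it to 64/27 < 4.
  have e43 : Real.logb 2 (4 / 3) < 2 / 3 := by
    rw [Real.logb_lt_iff_lt_rpow one_lt_two (by norm_num)]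
    by_contra hcon
    push Not at hcon
    have h3 := pow_le_pow_left₀ (by positivity) hcon 3
    rw [← Real.rpow_natCast, ← Real.rpow_mul (by norm_num)] at h3
    norm_num at h3
  rw [e4]
  linarith

theorem isIndepChannel_singleton (G : SimpleGraph V) :
    IsIndepChannel G (detKernel fun v => ({v} : Finset V)) := by
  refine ⟨isChannel_detKernel _, fun v w h => ?_⟩
  rw [eq_of_detKernel_pos h]
  simp

/-- In a complete graph, the only channel allowed reveals the vertex. -/
theorem IsIndepChannel.eq_detKernel {κ : V → Finset V → ℝ}
    (h : IsIndepChannel (⊤ : SimpleGraph V) κ) : κ = detKernel fun v => ({v} : Finset V) := by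
  classical
  have hz : ∀ v w, w ≠ {v} → κ v w = 0 := by
    intro v w hw
    by_contra hne
    obtain ⟨h1, h2⟩ := h.2 v w (((h.1 v).1 w).lt_of_ne' hne)
    refine hw (Finset.eq_singleton_iff_unique_mem.mpr ⟨h1, fun x hx => ?_⟩)
    by_contra hxv
    exact h2 hx h1 hxv hxv
  funext v w
  by_cases hw : w = {v}
  · have := (h.1 v).2
    rw [Finset.sum_eq_single {v} (fun w _ => hz v w) (by simp)] at this
    simp [detKernel, hw, this]
  · simp [detKernel, hw, hz v w hw]

theorem graphEntropy_top (P : V → ℝ) :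
    graphEntropy (⊤ : SimpleGraph V) P =
      mutualInfo (jointPmf P (detKernel fun v => ({v} : Finset V))) := by
  unfold graphEntropy
  rw [show {t | ∃ κ : V → Finset V → ℝ, IsIndepChannel (⊤ : SimpleGraph V) κ ∧
      t = mutualInfo (jointPmf P κ)} =
      {mutualInfo (jointPmf P (detKernel fun v => ({v} : Finset V)))} from ?_, csInf_singleton]
  ext t
  constructor
  · rintro ⟨κ, hκ, rfl⟩
    rw [hκ.eq_detKernel]; rfl
  · rintro rfl
    exact ⟨_, isIndepChannel_singleton _, rfl⟩

end

/-! ### The two examples with the OR function -/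

/-- The distribution on `{0,1}²` with mass `a`, `b`, `c` at `(0,0)`, `(0,1)`, `(1,0)`. -/
def cornerPmf (a b c : ℝ) (z : Fin 2 × Fin 2) : ℝ := !![a, b; c, 0] z.1 z.2

/-- The disjunction of two bits. -/
def orFun (x y : Fin 2) : Fin 2 := max x y

section
variable {a b c : ℝ}

theorem cornerPmf_mem (ha : 0 < a) (hb : 0 < b) (hc : 0 < c) (h : a + b + c = 1) :
    cornerPmf a b c ∈ stdSimplex ℝ (Fin 2 × Fin 2) := by
  constructor
  · rintro ⟨x, y⟩
    fin_cases x <;> fin_cases y <;> simp [cornerPmf, ha.le, hb.le, hc.le]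
  · rw [Fintype.sum_prod_type]
    simp [cornerPmf, Fin.sum_univ_two]
    linarith

theorem orFun_ne {x y x' y' : Fin 2} (h : orFun x y ≠ orFun x' y') :
    (x = 0 ∧ y = 0) ∨ (x' = 0 ∧ y' = 0) := by
  revert x y x' y'
  decide

/-- Against y = 0 both values of x have positive mass and OR equals x. -/
theorem confGraphX_corner (ha : 0 < a) (hc : 0 < c) : confGraphX (cornerPmf a b c) orFun = ⊤ := by
  refine eq_top_iff.mpr fun x x' hne => ⟨0, ?_⟩
  have hne : x ≠ x' := hne
  fin_cases x <;> fin_cases x' <;> simp_all [cornerPmf, orFun]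

theorem confGraphY_corner (ha : 0 < a) (hb : 0 < b) : confGraphY (cornerPmf a b c) orFun = ⊤ := by
  refine eq_top_iff.mpr fun x x' hne => ⟨0, ?_⟩
  have hne : x ≠ x' := hne
  fin_cases x <;> fin_cases x' <;> simp_all [cornerPmf, orFun]

/-- The channel that reveals a bit. -/
noncomputable abbrev bitKernel : Fin 2 → Finset (Fin 2) → ℝ := detKernel fun v => {v}

theorem pmfUU_corner :
    pmfUU (cornerPmf a b c) bitKernel bitKernel ({0}, {0}) = a := by
  simp [pmfUU, jointXUYU, cornerPmf, detKernel]

/-- With P(X = 0) = 1/2 the bit X has one full bit of entropy, so `regionI2` forces R_C ≥ 1. In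
`regionI1` the relay only announces the event (0,0), of probability 1/4. -/
theorem not_regionI1_subset_regionI2 :
    ¬ (regionI1 (cornerPmf (1 / 4) (1 / 4) (1 / 2)) orFun ⊆
      regionI2 (cornerPmf (1 / 4) (1 / 4) (1 / 2)) orFun) := by
  classical
  intro hsub
  set p := cornerPmf (1 / 4) (1 / 4) (1 / 2) with hpdef
  have hp : p ∈ stdSimplex ℝ (Fin 2 × Fin 2) :=
    cornerPmf_mem (by norm_num) (by norm_num) (by norm_num) (by norm_num)
  have hX : confGraphX p orFun = ⊤ := confGraphX_corner (by norm_num) (by norm_num)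
  set u₀ : Finset (Fin 2) × Finset (Fin 2) := ({0}, {0}) with hu₀
  -- The complement of `u₀` is independent: an edge needs two possible pairs with different ORs, one
  -- of which must be `u₀`. Pairs of probability zero are isolated.
  set φ : Finset (Fin 2) × Finset (Fin 2) → Finset (Finset (Fin 2) × Finset (Fin 2)) :=
    fun u => if u = u₀ then {u₀} else {u₀}ᶜ with hφ
  have hlt : mutualInfo (jointPmf (pmfUU p bitKernel bitKernel) (detKernel φ)) < 1 := by
    refine mutualInfo_detKernel_lt_one
      (pairPmf_mem hp (isChannel_detKernel _) (isChannel_detKernel _)) u₀ φ {u₀}ᶜ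
      (fun v hv => by simp [hφ, hv]) ?_ pmfUU_corner
    intro h
    have : u₀ ∈ ({u₀}ᶜ : Finset (Finset (Fin 2) × Finset (Fin 2))) := by
      rw [← h]; simp [hφ]
    simp at this
  have hW : IsIndepChannel (auxGraph p orFun bitKernel bitKernel) (detKernel φ) := by
    refine ⟨isChannel_detKernel φ, fun u w h => ?_⟩
    rw [eq_of_detKernel_pos h, hφ]
    dsimp only
    split_ifs with hu
    · simp [hu]
    · refine ⟨by simpa using hu, fun u₁ h₁ u₂ h₂ _ hadj => ?_⟩
      obtain ⟨-, x, y, x', y', j, j', hor⟩ := hadj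
      have hf : orFun x y ≠ orFun x' y' := by
        rcases hor with h | h
        · exact h.2.2
        · exact h.2.2
      have pos : ∀ {x y} {u : Finset (Fin 2) × Finset (Fin 2)},
          0 < jointXUYU p bitKernel bitKernel x u.1 y u.2 → u = ({x}, {y}) := by
        intro x y u hj
        have hpk := pos_of_mul_pos_right hj
          (mul_nonneg (hp.1 _) ((isChannel_detKernel _ x).1 _))
        have hpp := pos_of_mul_pos_right
          ((pos_iff_pos_of_mul_pos hj).2 hpk) (hp.1 _)
        exact Prod.ext (eq_of_detKernel_pos hpp) (eq_of_detKernel_pos hpk)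
      rcases orFun_ne hf with ⟨rfl, rfl⟩ | ⟨rfl, rfl⟩
      · have := pos j
        simp [this, hu₀] at h₁
      · have := pos j'
        simp [this, hu₀] at h₂
  have hmem := hsub (show (mutualInfo (jointPmf (margX p) bitKernel),
      mutualInfo (jointPmf (margY p) bitKernel),
      mutualInfo (jointPmf (pmfUU p bitKernel bitKernel) (detKernel φ))) ∈ regionI1 p orFun from
    ⟨1, fun _ => 1, fun _ => bitKernel, fun _ => bitKernel, fun _ => detKernel φ,
      ⟨fun _ => zero_le_one, by simp⟩, fun _ => isIndepChannel_singleton _,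
      fun _ => isIndepChannel_singleton _, fun _ => hW, by simp, by simp, by simp⟩)
  have h1 : 1 ≤ graphEntropy (confGraphX p orFun) (margX p) := by
    rw [hX, graphEntropy_top]
    refine one_le_mutualInfo (margX_mem hp) (isChannel_detKernel _) (fun v => v = 0)
      (fun w => w = {0}) (fun v w _ h => ?_) ?_
    · rw [eq_of_detKernel_pos h]; simp
    · simp [margX, hpdef, cornerPmf, Fin.sum_univ_two]
      norm_num
  have h2 := (le_max_left _ _).trans hmem.2.2
  linarith

/-- Now P(0,0) = 1/2 while P(X = 1) = P(Y = 1) = 1/4. The bits are forced through, and `u₀` is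
adjacent to every other possible pair, so W always reveals the unbiased event (0,0). Time sharing
cannot help, because the bound holds for every q. -/
theorem not_regionI2_subset_regionI1 :
    ¬ (regionI2 (cornerPmf (1 / 2) (1 / 4) (1 / 4)) orFun ⊆
      regionI1 (cornerPmf (1 / 2) (1 / 4) (1 / 4)) orFun) := by
  classical
  intro hsub
  set p := cornerPmf (1 / 2) (1 / 4) (1 / 4) with hpdef
  have hp : p ∈ stdSimplex ℝ (Fin 2 × Fin 2) :=
    cornerPmf_mem (by norm_num) (by norm_num) (by norm_num) (by norm_num)
  have hX : confGraphX p orFun = ⊤ := confGraphX_corner (by norm_num) (by norm_num)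
  have hY : confGraphY p orFun = ⊤ := confGraphY_corner (by norm_num) (by norm_num)
  have hne : ∀ v : Fin 2, v ≠ 1 → v = 0 := by decide
  have lX : graphEntropy (confGraphX p orFun) (margX p) < 1 := by
    rw [hX, graphEntropy_top]
    refine mutualInfo_detKernel_lt_one (margX_mem hp) 1 _ {0} (fun v hv => by rw [hne v hv])
      (by simp) ?_
    simp [margX, hpdef, cornerPmf, Fin.sum_univ_two]
  have lY : graphEntropy (confGraphY p orFun) (margY p) < 1 := by
    rw [hY, graphEntropy_top]
    refine mutualInfo_detKernel_lt_one (margY_mem hp) 1 _ {0} (fun v hv => by rw [hne v hv])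
      (by simp) ?_
    simp [margY, hpdef, cornerPmf, Fin.sum_univ_two]
  have hmem := hsub (show (graphEntropy (confGraphX p orFun) (margX p),
    graphEntropy (confGraphY p orFun) (margY p), max (graphEntropy (confGraphX p orFun) (margX p))
      (graphEntropy (confGraphY p orFun) (margY p))) ∈ regionI2 p orFun from
    ⟨le_rfl, le_rfl, le_rfl⟩)
  obtain ⟨k, pQ, κ₁, κ₂, κW, hQ, h₁, h₂, hW, -, -, hC⟩ := hmem
  have h1 : ∀ q, 1 ≤ mutualInfo (jointPmf (pmfUU p (κ₁ q) (κ₂ q)) (κW q)) := by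
    intro q
    have e₁ : κ₁ q = bitKernel := IsIndepChannel.eq_detKernel (hX ▸ h₁ q)
    have e₂ : κ₂ q = bitKernel := IsIndepChannel.eq_detKernel (hY ▸ h₂ q)
    have hWq := hW q
    rw [e₁, e₂] at hWq ⊢
    refine one_le_mutualInfo (pairPmf_mem hp (isChannel_detKernel _) (isChannel_detKernel _))
      hWq.1 (fun u => u = ({0}, {0})) (fun w => (({0}, {0}) : Finset (Fin 2) × Finset (Fin 2)) ∈ w)
      (fun u w hu hκ => ?_) ?_
    · obtain ⟨huw, hind⟩ := hWq.2 u w hκ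
      refine ⟨fun h => h ▸ huw, fun h0 => ?_⟩
      by_contra hne
      refine hind huw h0 hne ⟨hne, ?_⟩
      obtain ⟨x, y, hxy⟩ : ∃ x y, 0 < jointXUYU p bitKernel bitKernel x u.1 y u.2 := by
        by_contra hcon
        push Not at hcon
        exact hu.not_ge (Finset.sum_nonpos fun x _ => Finset.sum_nonpos fun y _ => hcon x y)
      refine ⟨x, y, 0, 0, hxy, by simp [jointXUYU, hpdef, cornerPmf, detKernel], ?_⟩
      have hpk := pos_of_mul_pos_right hxy
        (mul_nonneg (hp.1 _) ((isChannel_detKernel _ x).1 _))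
      have hpp := (pos_iff_pos_of_mul_pos hxy).2 hpk
      have hk1 := pos_of_mul_pos_right hpp (hp.1 _)
      have hpxy := (pos_iff_pos_of_mul_pos hpp).2 hk1
      have hu' : u = ({x}, {y}) := Prod.ext (eq_of_detKernel_pos hk1) (eq_of_detKernel_pos hpk)
      subst hu'
      -- The point (1,1) has mass zero, so a possible pair other than (0,0) shares exactly one
      -- coordinate with it.
      fin_cases x <;> fin_cases y <;> simp_all [orFun, cornerPmf]
    · rw [Finset.sum_ite_eq' Finset.univ _ (pmfUU p bitKernel bitKernel),
        if_pos (Finset.mem_univ _)]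
      exact pmfUU_corner
  have h2 : (1 : ℝ) ≤ ∑ q, pQ q * mutualInfo (jointPmf (pmfUU p (κ₁ q) (κ₂ q)) (κW q)) := by
    rw [← hQ.2]
    exact Finset.sum_le_sum fun q _ => le_mul_of_one_le_right (hQ.1 q) (h1 q)
  have h3 := max_lt lX lY
  exact absurd (h2.trans hC) (not_le.mpr h3)

end

end RelayNet

theorem theorem3 :
    -- (a) the convex closure of the union lies in the unrestricted-input rate region
    (∀ (𝒳 : Type*) (𝒴 : Type*) (𝒵 : Type*) [Fintype 𝒳] [Fintype 𝒴]
      (p : 𝒳 × 𝒴 → ℝ) (f : 𝒳 → 𝒴 → 𝒵), p ∈ stdSimplex ℝ (𝒳 × 𝒴) →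
      closure (convexHull ℝ (RelayNet.regionI1 p f ∪ RelayNet.regionI2 p f)) ⊆
        RelayNet.unrestrictedRegion p f) ∧
    -- (b) in general, neither of the two regions is a subset of the other
    (∃ (a b c : ℕ) (p : Fin a × Fin b → ℝ) (f : Fin a → Fin b → Fin c),
      p ∈ stdSimplex ℝ (Fin a × Fin b) ∧
      ¬ (RelayNet.regionI1 p f ⊆ RelayNet.regionI2 p f)) ∧
    (∃ (a b c : ℕ) (p : Fin a × Fin b → ℝ) (f : Fin a → Fin b → Fin c),
      p ∈ stdSimplex ℝ (Fin a × Fin b) ∧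
      ¬ (RelayNet.regionI2 p f ⊆ RelayNet.regionI1 p f)) := by
  refine ⟨fun 𝒳 𝒴 𝒵 _ _ p f hp => RelayNet.convexClosure_subset_unrestrictedRegion hp f,
    ⟨2, 2, 2, _, RelayNet.orFun, RelayNet.cornerPmf_mem ?_ ?_ ?_ ?_,
      RelayNet.not_regionI1_subset_regionI2⟩,
    ⟨2, 2, 2, _, RelayNet.orFun, RelayNet.cornerPmf_mem ?_ ?_ ?_ ?_,
      RelayNet.not_regionI2_subset_regionI1⟩⟩ <;> norm_num
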